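/- Let $n\ge 3$ and let $p>1$ be real. Let $\mathcal P^n$ be the set of all convex polytopes in $\mathbb R^n$ (convex hulls of nonempty finite sets), and let $C_p$ be the vector space of continuous functions $f:\mathbb R^n\to\mathbb R$ with $f(su)=s^pf(u)$ for all $s>0$ and $u\in\mathbb R^n$. Let $\Phi:\mathcal P^n\to C_p$ be - a valuation: $\Phi(K\cup L)+\Phi(K\cap L)=\Phi(K)+\Phi(L)$ for all $K,L\in\mathcal P^n$ with $K\cup L,\,K\cap L\in\mathcal P^n$; - simple: $\Phi(P)=0$ whenever $\dim P<n$; - $\mathrm{SL}(n)$-contravariant: $\Phi(\phi P)=\Phi(P)\circ\phi^{-1}$ for all $P\in\mathcal P^n$ and $\phi\in\mathrm{SL}(n)$. Let $T^n=\operatorname{conv}\{0,e_1,\dots,e_n\}$ be the standard simplex, and assume that for every $y\in\mathbb R^n$ there is a nonempty bounded open interval $I_y\subseteq(0,\infty)$ such that the set $\{\Phi(sT^n)(y): s\in I_y\}$ is not dense in $\mathbb R$. Then there are constants $c_1,c_2\in\mathbb R$ such that $$\Phi(P)=c_1\,\Delta_p^+P+c_2\,\Delta_p^-P\qquad\text{for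 all }P\in\mathcal P^n .$$ Here, for $P\in\mathcal P^n$, let $h(P,u)=\max_{x\in P}\langle x,u\rangle$ be the support function and $F(P,v)=P\cap\{x:\langle x,v\rangle=h(P,v)\}$, let $\mathcal N(P)$ be the (finite) set of unit vectors $v$ with $\dim F(P,v)=n-1$, and put $t_+=\max\{t,0\}$, $t_-=\max\{-t,0\}$ for real $t$. Then $\Delta_p^{\pm}P:\mathbb R^n\to\mathbb R$ are the functions $$\Delta_p^{\pm}P(u)=\sum_{\substack{v\in\mathcal N(P)\\ h(P,v)>0}}\operatorname{vol}_{n-1}(F(P,v))\,h(P,v)^{1-p}\,\langle v,u\rangle_{\pm}^p\;-\sum_{\substack{v\in\mathcal N(P)\\ h(P,v)<0}}\operatorname{vol}_{n-1}(F(P,v))\,|h(P,v)|^{1-p}\,\langle v,u\rangle_{\mp}^p .$$ -/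

import Mathlib

/-- A convex polytope in `ℝⁿ`: the convex hull of a nonempty finite set of points. -/
@[ext]
structure ConvexPolytope (n : ℕ) where
  carrier : Set (EuclideanSpace ℝ (Fin n))
  exists_finset' : ∃ s : Finset (EuclideanSpace ℝ (Fin n)),
    s.Nonempty ∧ carrier = convexHull ℝ (s : Set (EuclideanSpace ℝ (Fin n)))

namespace ConvexPolytope

variable {n : ℕ}

/-- The image of a polytope under a linear map. -/
def map (f : EuclideanSpace ℝ (Fin n) →ₗ[ℝ] EuclideanSpace ℝ (Fin n))
    (P : ConvexPolytope n) : ConvexPolytope n where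
  carrier := f '' P.carrier
  exists_finset' := by
    classical
    obtain ⟨s, hs, h⟩ := P.exists_finset'
    refine ⟨s.image f, hs.image f, ?_⟩
    rw [h, LinearMap.image_convexHull, Finset.coe_image]

/-- The dilate `sP = {s x : x ∈ P}`. -/
def dilate (s : ℝ) (P : ConvexPolytope n) : ConvexPolytope n :=
  P.map (s • LinearMap.id)

/-- The image `φP` for `φ ∈ SL(n)`. -/
noncomputable def slImage (φ : Matrix.SpecialLinearGroup (Fin n) ℝ) (P : ConvexPolytope n) :
    ConvexPolytope n :=
  P.map (Matrix.toEuclideanLin (φ : Matrix (Fin n) (Fin n) ℝ))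

/-- The standard simplex `Tⁿ = conv {o, e₁, …, eₙ}`. -/
def stdSimplex (n : ℕ) : ConvexPolytope n where
  carrier := convexHull ℝ
    (insert 0 (Set.range fun i : Fin n => EuclideanSpace.single i (1 : ℝ)))
  exists_finset' := by
    classical
    refine ⟨insert 0 (Finset.univ.image fun i : Fin n => EuclideanSpace.single i (1 : ℝ)),
      Finset.insert_nonempty _ _, ?_⟩
    simp

/-- The dimension of a polytope (the dimension of its affine hull). -/
noncomputable def dim (P : ConvexPolytope n) : ℕ :=
  Module.finrank ℝ (vectorSpan ℝ P.carrier)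

/-- The support function `h(P, u) = max_{x ∈ P} ⟨x, u⟩`. -/
noncomputable def supp (P : ConvexPolytope n) (u : EuclideanSpace ℝ (Fin n)) : ℝ :=
  sSup ((fun x => inner ℝ x u) '' P.carrier)

/-- `F(P, v) = P ∩ {x : ⟨x, v⟩ = h(P, v)}`. -/
def face (P : ConvexPolytope n) (v : EuclideanSpace ℝ (Fin n)) :
    Set (EuclideanSpace ℝ (Fin n)) :=
  {x | x ∈ P.carrier ∧ inner ℝ x v = P.supp v}

/-- `𝒩(P)`: the unit vectors `v` for which `F(P, v)` has dimension `n - 1`. -/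
def facetNormals (P : ConvexPolytope n) : Set (EuclideanSpace ℝ (Fin n)) :=
  {v | ‖v‖ = 1 ∧ Module.finrank ℝ (vectorSpan ℝ (P.face v)) + 1 = n}

/-- `vol_{n-1}(F(P, v))`. -/
noncomputable def faceVol (P : ConvexPolytope n) (v : EuclideanSpace ℝ (Fin n)) : ℝ :=
  (MeasureTheory.Measure.euclideanHausdorffMeasure (n - 1) (P.face v)).toReal

end ConvexPolytope

/-- `h(Π_p^{>,+} P, u)^p`. -/
noncomputable def hPiPlusGt {n : ℕ} (p : ℝ) (P : ConvexPolytope n)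
    (u : EuclideanSpace ℝ (Fin n)) : ℝ :=
  ∑ᶠ v ∈ {v | v ∈ P.facetNormals ∧ 0 < P.supp v},
    P.faceVol v * |P.supp v| ^ (1 - p) * (max (inner ℝ v u) 0) ^ p

/-- `h(Π_p^{>,-} P, u)^p`. -/
noncomputable def hPiMinusGt {n : ℕ} (p : ℝ) (P : ConvexPolytope n)
    (u : EuclideanSpace ℝ (Fin n)) : ℝ :=
  ∑ᶠ v ∈ {v | v ∈ P.facetNormals ∧ 0 < P.supp v},
    P.faceVol v * |P.supp v| ^ (1 - p) * (max (-inner ℝ v u) 0) ^ p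

/-- `h(Π_p^{<,+} P, u)^p`. -/
noncomputable def hPiPlusLt {n : ℕ} (p : ℝ) (P : ConvexPolytope n)
    (u : EuclideanSpace ℝ (Fin n)) : ℝ :=
  ∑ᶠ v ∈ {v | v ∈ P.facetNormals ∧ P.supp v < 0},
    P.faceVol v * |P.supp v| ^ (1 - p) * (max (inner ℝ v u) 0) ^ p

/-- `h(Π_p^{<,-} P, u)^p`. -/
noncomputable def hPiMinusLt {n : ℕ} (p : ℝ) (P : ConvexPolytope n)
    (u : EuclideanSpace ℝ (Fin n)) : ℝ :=
  ∑ᶠ v ∈ {v | v ∈ P.facetNormals ∧ P.supp v < 0},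
    P.faceVol v * |P.supp v| ^ (1 - p) * (max (-inner ℝ v u) 0) ^ p

/-- `Δ_p^+ P = h(Π_p^{>,+} P, ·)^p - h(Π_p^{<,-} P, ·)^p`. -/
noncomputable def deltaPlus {n : ℕ} (p : ℝ) (P : ConvexPolytope n)
    (u : EuclideanSpace ℝ (Fin n)) : ℝ :=
  hPiPlusGt p P u - hPiMinusLt p P u

/-- `Δ_p^- P = h(Π_p^{>,-} P, ·)^p - h(Π_p^{<,+} P, ·)^p`. -/
noncomputable def deltaMinus {n : ℕ} (p : ℝ) (P : ConvexPolytope n)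
    (u : EuclideanSpace ℝ (Fin n)) : ℝ :=
  hPiMinusGt p P u - hPiPlusLt p P u

/-- `C_p`: the vector space of continuous `p`-homogeneous functions on `ℝⁿ`. -/
def Cp (n : ℕ) (p : ℝ) : Submodule ℝ C(EuclideanSpace ℝ (Fin n), ℝ) where
  carrier := {f | ∀ s : ℝ, 0 < s → ∀ u, f (s • u) = s ^ p * f u}
  add_mem' := by
    intro f g hf hg s hs u
    simp only [ContinuousMap.add_apply, hf s hs u, hg s hs u, mul_add]
  zero_mem' := by
    intro s hs u
    simp
  smul_mem' := by
    intro c f hf s hs u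
    simp only [ContinuousMap.smul_apply, hf s hs u, smul_eq_mul]
    ring

/-- The valuation property on `𝒫ⁿ`: `Φ(K ∪ L) + Φ(K ∩ L) = Φ(K) + Φ(L)` whenever
`K ∪ L` and `K ∩ L` are polytopes (called `U` and `I` below). -/
def IsValuation {n : ℕ} {A : Type*} [AddCommMonoid A] (Φ : ConvexPolytope n → A) : Prop :=
  ∀ K L U I : ConvexPolytope n, U.carrier = K.carrier ∪ L.carrier →
    I.carrier = K.carrier ∩ L.carrier → Φ U + Φ I = Φ K + Φ L

/-- A map on `𝒫ⁿ` is simple if it vanishes on lower-dimensional polytopes. -/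
def IsSimple {n : ℕ} {A : Type*} [AddCommMonoid A] (Φ : ConvexPolytope n → A) : Prop :=
  ∀ P : ConvexPolytope n, P.dim < n → Φ P = 0

/-- `SL(n)`-contravariance: `Φ(φP) = Φ(P) ∘ φ⁻¹`. -/
def IsSLContravariant {n : ℕ} {p : ℝ} (Φ : ConvexPolytope n → Cp n p) : Prop :=
  ∀ (P : ConvexPolytope n) (φ : Matrix.SpecialLinearGroup (Fin n) ℝ)
    (u : EuclideanSpace ℝ (Fin n)),
    (Φ (P.slImage φ)).1 u =
      (Φ P).1 (Matrix.toEuclideanLin ((φ⁻¹ : Matrix.SpecialLinearGroup (Fin n) ℝ) :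
        Matrix (Fin n) (Fin n) ℝ) u)

/-! Fix `u`. Both sides of the claimed identity, as functions of `P`, are additive when `P` is cut
by a hyperplane and vanish when `P` lies in a hyperplane. For `Φ` this is the valuation property
plus simplicity. For `deltaPlus` it rests on an oddness: the two halves see the new facet with
opposite normals and opposite support numbers, and the weight changes sign under this reversal
(`facetWeight_neg`).

A function with these two properties that is zero on every nondegenerate simplex with a vertex at
the origin is zero on all polytopes (`IsDissective.eq_zero`). So only such simplices, spanned by `0`
and a basis `x`, have to be compared.

On them `deltaPlus` sees only the facet opposite the origin, as the other facets have support number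
`0`. At the point `∑ yᵢ xᵢ` it equals `V |det x| (∑ yᵢ)₊ ^ p`, with `V` the volume of the standard
corner simplex one dimension lower (`deltaPlus_cornerSimplex`).

For `Φ`, contravariance makes the value a function `G(t, y)` of the determinant `t` and the
coordinates `y` alone. Cutting the simplex through a point of an edge gives a functional equation
for `G` (`EdgeEquation`). A continuous homogeneous solution that vanishes at all `±eᵢ` is zero
(`EdgeEquation.eq_zero`), so `G` is determined by its values there. Even permutations of the
vertices make these values independent of `i`. Cutting an edge not ending at `xᵢ` leaves `±eᵢ` fixed
and gives Cauchy's equation in `t`; since a nonlinear solution has a dense graph, the non-density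
hypothesis forces linearity. Both facts need a third index, hence `n ≥ 3`. Therefore `G(t, y) = t
(c₁ (∑ yᵢ)₊ ^ p + c₂ (∑ yᵢ)₋ ^ p)`, which matches the `Δ` side up to the factor `V`. -/

/-! ### Polytopes as sets: halfspace sections and halfspace representation -/

/-- A set is a hull if it is the convex hull of a finite (possibly empty) set. -/
def IsHull {E : Type*} [AddCommGroup E] [Module ℝ E] (A : Set E) : Prop :=
  ∃ s : Finset E, A = convexHull ℝ (s : Set E)

/-- The intersection of the halfspaces `{x | f x ≤ c}` over a list of pairs `(f, c)`. -/
def polyhedron {E : Type*} [AddCommGroup E] [Module ℝ E] (T : List ((E →ₗ[ℝ] ℝ) × ℝ)) : Set E :=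
  {x | ∀ p ∈ T, p.1 x ≤ p.2}

section Hull

variable {E : Type*} [AddCommGroup E] [Module ℝ E]

theorem polyhedron_nil : polyhedron ([] : List ((E →ₗ[ℝ] ℝ) × ℝ)) = Set.univ := by
  simp [polyhedron]

theorem polyhedron_cons (p : (E →ₗ[ℝ] ℝ) × ℝ) (T : List ((E →ₗ[ℝ] ℝ) × ℝ)) :
    polyhedron (p :: T) = polyhedron T ∩ {x | p.1 x ≤ p.2} := by
  ext x; simp [polyhedron, and_comm]

theorem IsHull.convex {A : Set E} (hA : IsHull A) : Convex ℝ A := by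
  obtain ⟨s, rfl⟩ := hA
  exact convex_convexHull ℝ _

theorem convex_setOf_le (f : E →ₗ[ℝ] ℝ) (c : ℝ) : Convex ℝ {x | f x ≤ c} :=
  convex_halfSpace_le f.isLinear c

/-- A halfspace section of a polytope is a polytope: it is spanned by the vertices in the
halfspace and the points where segments between vertices cross the boundary hyperplane. -/
theorem IsHull.inter_le {A : Set E} (hA : IsHull A) (f : E →ₗ[ℝ] ℝ) (c : ℝ) :
    IsHull (A ∩ {x | f x ≤ c}) := by
  classical
  obtain ⟨s, rfl⟩ := hA
  set lo := s.filter fun x => f x ≤ c with hlo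
  set hi := s.filter fun x => ¬ f x ≤ c with hhi
  -- The point where the segment from `p.1` to `p.2` meets the hyperplane `f = c`.
  let z : E × E → E := fun p =>
    (f p.2 - f p.1)⁻¹ • ((f p.2 - c) • p.1 + (c - f p.1) • p.2)
  have hgap : ∀ p ∈ lo ×ˢ hi, 0 ≤ c - f p.1 ∧ 0 < f p.2 - c ∧ 0 < f p.2 - f p.1 := by
    intro p hp
    simp only [hlo, hhi, Finset.mem_product, Finset.mem_filter, not_le] at hp
    refine ⟨?_, ?_, ?_⟩ <;> linarith [hp.1.2, hp.2.2]
  refine ⟨lo ∪ (lo ×ˢ hi).image z, Set.Subset.antisymm ?_ ?_⟩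
  · rintro x ⟨hx, hxc⟩
    obtain ⟨w, hw0, hw1, hwx⟩ := Finset.mem_convexHull'.1 hx
    -- `D₁` and `D₂` are the weighted deficit below and excess above level `c`; `f x ≤ c` says
    -- exactly that `D₂ ≤ D₁`.
    set D₁ := ∑ y ∈ lo, w y * (c - f y) with hD₁
    set D₂ := ∑ y ∈ hi, w y * (f y - c) with hD₂
    have hw0l : ∀ y ∈ lo, 0 ≤ w y := fun y hy => hw0 y (Finset.mem_of_mem_filter y hy)
    have hw0h : ∀ y ∈ hi, 0 ≤ w y := fun y hy => hw0 y (Finset.mem_of_mem_filter y hy)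
    have hsplit1 : ∑ y ∈ lo, w y + ∑ y ∈ hi, w y = 1 := by
      rw [← hw1, Finset.sum_filter_add_sum_filter_not]
    have hsplitx : ∑ y ∈ lo, w y • y + ∑ y ∈ hi, w y • y = x := by
      rw [← hwx, Finset.sum_filter_add_sum_filter_not]
    have hD : D₂ ≤ D₁ := by
      have h1 : D₁ - D₂ = c - f x := by
        have : D₁ - D₂ = ∑ y ∈ lo, w y * (c - f y) + ∑ y ∈ hi, w y * (c - f y) := by
          rw [hD₁, hD₂, sub_eq_add_neg, ← Finset.sum_neg_distrib]
          congr 1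
          exact Finset.sum_congr rfl fun y _ => by ring
        rw [this, Finset.sum_filter_add_sum_filter_not, ← hwx, map_sum]
        simp only [map_smul, smul_eq_mul, mul_sub, Finset.sum_sub_distrib, ← Finset.sum_mul, hw1,
          one_mul]
      have : f x ≤ c := hxc
      linarith
    have hD2 : 0 ≤ D₂ := Finset.sum_nonneg fun y hy => mul_nonneg (hw0h y hy) (by
      simp only [hhi, Finset.mem_filter, not_le] at hy; linarith [hy.2])
    rcases hD2.eq_or_lt with h0 | hpos
    · have hz : ∀ y ∈ hi, w y = 0 := by
        intro y hy
        have hyc : 0 < f y - c := by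
          simp only [hhi, Finset.mem_filter, not_le] at hy; linarith [hy.2]
        have := (Finset.sum_eq_zero_iff_of_nonneg (fun y hy => mul_nonneg (hw0h y hy) (by
          simp only [hhi, Finset.mem_filter, not_le] at hy; linarith [hy.2]))).1 h0.symm y hy
        rcases mul_eq_zero.1 this with h | h
        · exact h
        · linarith
      rw [Finset.sum_eq_zero hz, add_zero] at hsplit1
      have hz' : ∑ y ∈ hi, w y • y = 0 :=
        Finset.sum_eq_zero fun y hy => by rw [hz y hy, zero_smul]
      rw [hz', add_zero] at hsplitx
      rw [← hsplitx]
      refine (convex_convexHull ℝ _).sum_mem hw0l hsplit1 fun y hy => ?_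
      exact subset_convexHull ℝ _ (by simp [hy])
    · have hD1 : 0 < D₁ := hpos.trans_le hD
      -- A transport plan: pairing every low vertex with every high one uses up all the high mass
      -- and the fraction `D₂ / D₁` of each low mass. The rest stays at the low vertices.
      let ω : (E × E) ⊕ E → ℝ := Sum.elim
        (fun p => w p.1 * w p.2 * (f p.2 - f p.1) / D₁) (fun y => w y * (1 - D₂ / D₁))
      let q : (E × E) ⊕ E → E := Sum.elim z id
      have hx' : ∑ i ∈ (lo ×ˢ hi).disjSum lo, ω i • q i = x := by
        have e1 : ∀ p ∈ lo ×ˢ hi, (w p.1 * w p.2 * (f p.2 - f p.1) / D₁) • z p =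
            (w p.1 * D₁⁻¹) • (w p.2 * (f p.2 - c)) • p.1 +
            (D₁⁻¹ * (w p.1 * (c - f p.1))) • w p.2 • p.2 := by
          intro p hp
          have hne := (hgap p hp).2.2.ne'
          simp only [z, smul_smul, smul_add]
          congr 2 <;> field_simp
        rw [Finset.sum_disjSum]
        simp only [ω, q, Sum.elim_inl, Sum.elim_inr, id]
        rw [Finset.sum_congr rfl e1, Finset.sum_add_distrib, Finset.sum_product,
          Finset.sum_product]
        simp only [← Finset.smul_sum, ← Finset.sum_smul]
        rw [← Finset.mul_sum, ← hD₁, inv_mul_cancel₀ hD1.ne', one_smul, add_right_comm,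
          ← Finset.sum_add_distrib, ← hsplitx]
        congr 1
        refine Finset.sum_congr rfl fun y _ => ?_
        rw [← hD₂, smul_smul, ← add_smul]
        congr 1
        field_simp
        ring
      rw [← hx']
      refine (convex_convexHull ℝ _).sum_mem ?_ ?_ ?_
      · rintro (p | y) hi
        · rw [Finset.inl_mem_disjSum] at hi
          have := hgap p hi
          rw [Finset.mem_product] at hi
          exact div_nonneg (mul_nonneg (mul_nonneg (hw0l _ hi.1) (hw0h _ hi.2)) this.2.2.le) hD1.le
        · rw [Finset.inr_mem_disjSum] at hi
          exact mul_nonneg (hw0l _ hi) (sub_nonneg.2 ((div_le_one hD1).2 hD))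
      · have e1 : ∀ p ∈ lo ×ˢ hi, w p.1 * w p.2 * (f p.2 - f p.1) / D₁ =
            (w p.1 * D₁⁻¹) * (w p.2 * (f p.2 - c)) +
            (D₁⁻¹ * (w p.1 * (c - f p.1))) * w p.2 := by
          intro p _
          field_simp
          ring
        rw [Finset.sum_disjSum]
        simp only [ω, Sum.elim_inl, Sum.elim_inr]
        rw [Finset.sum_congr rfl e1, Finset.sum_add_distrib, Finset.sum_product,
          Finset.sum_product]
        simp only [← Finset.mul_sum, ← Finset.sum_mul]
        rw [← hD₁, ← hD₂, inv_mul_cancel₀ hD1.ne', one_mul]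
        linear_combination hsplit1
      · rintro (p | y) hi
        · rw [Finset.inl_mem_disjSum] at hi
          refine subset_convexHull ℝ _ ?_
          rw [Finset.coe_union, Finset.coe_image]
          exact Or.inr ⟨p, hi, rfl⟩
        · rw [Finset.inr_mem_disjSum] at hi
          refine subset_convexHull ℝ _ ?_
          rw [Finset.coe_union]
          exact Or.inl hi
  · refine convexHull_min ?_ ((convex_convexHull ℝ _).inter (convex_setOf_le f c))
    rw [Finset.coe_union, Finset.coe_image]
    rintro x (hx | ⟨p, hp, rfl⟩)
    · rw [Finset.mem_coe, hlo, Finset.mem_filter] at hx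
      exact ⟨subset_convexHull ℝ _ hx.1, hx.2⟩
    · have hg := hgap p hp
      have hp' := hp
      simp only [Finset.coe_product, Set.mem_prod, Finset.mem_coe, hlo, hhi,
        Finset.mem_filter] at hp'
      refine ⟨?_, ?_⟩
      · have : z p = ((f p.2 - c) / (f p.2 - f p.1)) • p.1 +
            ((c - f p.1) / (f p.2 - f p.1)) • p.2 := by
          simp only [z, smul_add, smul_smul, div_eq_inv_mul]
        rw [this]
        refine convex_convexHull ℝ _ (subset_convexHull ℝ _ hp'.1.1)
          (subset_convexHull ℝ _ hp'.2.1) (div_nonneg hg.2.1.le hg.2.2.le)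
          (div_nonneg hg.1 hg.2.2.le) ?_
        rw [← add_div, sub_add_sub_cancel, div_self hg.2.2.ne']
      · have hne := hg.2.2.ne'
        rw [Set.mem_ofPred_eq]
        refine le_of_eq ?_
        simp only [z, map_smul, map_add, smul_eq_mul]
        field_simp
        ring

theorem IsHull.inter_ge {A : Set E} (hA : IsHull A) (f : E →ₗ[ℝ] ℝ) (c : ℝ) :
    IsHull (A ∩ {x | c ≤ f x}) := by
  have := hA.inter_le (-f) (-c)
  simpa using this

theorem IsHull.inter_polyhedron {A : Set E} (hA : IsHull A) (T : List ((E →ₗ[ℝ] ℝ) × ℝ)) :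
    IsHull (A ∩ polyhedron T) := by
  induction T with
  | nil => simpa [polyhedron_nil] using hA
  | cons p T ih =>
    rw [polyhedron_cons, ← Set.inter_assoc]
    exact ih.inter_le p.1 p.2

end Hull

/-! ### Polar duality: from vertices to halfspaces. -/

section Representation

variable {E : Type*} [NormedAddCommGroup E] [InnerProductSpace ℝ E]

theorem IsHull.isCompact {A : Set E} (hA : IsHull A) : IsCompact A := by
  obtain ⟨s, rfl⟩ := hA
  exact s.finite_toSet.isCompact_convexHull ℝ

variable [FiniteDimensional ℝ E]

open scoped Pointwise in
theorem exists_isHull_superset {B : Set E} (hB : Bornology.IsBounded B) :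
    ∃ A, IsHull A ∧ B ⊆ A := by
  obtain ⟨b, hb, -⟩ := exists_mem_interior_convexHull_affineBasis
    (s := Set.univ) (x := (0 : E)) Filter.univ_mem
  obtain ⟨ε, hε, hball⟩ := Metric.mem_nhds_iff.1 (mem_interior_iff_mem_nhds.1 hb)
  obtain ⟨R, hR0, hR⟩ := hB.exists_pos_norm_le
  classical
  refine ⟨(2 * R / ε) • convexHull ℝ (Set.range b),
    ⟨(Finset.univ.image b).image ((2 * R / ε) • ·), ?_⟩, fun x hx => ?_⟩
  · rw [← convexHull_smul]
    congr 1
    ext; simp [Set.mem_smul_set]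
  · have hk : 0 < 2 * R / ε := by positivity
    rw [Set.mem_smul_set_iff_inv_smul_mem₀ hk.ne']
    apply hball
    rw [mem_ball_zero_iff, norm_smul, norm_inv, Real.norm_of_nonneg hk.le, inv_div,
      div_mul_eq_mul_div, div_lt_iff₀ (by positivity)]
    nlinarith [hR x hx]

/-- A polytope with interior points is a finite intersection of halfspaces. -/
theorem IsHull.exists_polyhedron {A : Set E} (hA : IsHull A) (hint : (interior A).Nonempty) :
    ∃ T : List ((E →ₗ[ℝ] ℝ) × ℝ), (∀ p ∈ T, p.1 ≠ 0) ∧ A = polyhedron T := by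
  classical
  obtain ⟨a, ha⟩ := hint
  have hAconv := hA.convex
  have hAcl := hA.isCompact.isClosed
  obtain ⟨ε, hε, hball⟩ := Metric.mem_nhds_iff.1 (mem_interior_iff_mem_nhds.1 ha)
  obtain ⟨s, hs⟩ := hA
  -- `B` is the polar of `A - a`. It is bounded because `a` is interior, so by halfspace sections it
  -- is the hull of a finite set `r`; by the bipolar theorem the points of `r` are the normals that
  -- define `A`.
  let B : Set E := polyhedron (s.toList.map fun x => (innerₗ E (x - a), (1 : ℝ)))
  have hBmem : ∀ y, y ∈ B ↔ ∀ x ∈ A, inner ℝ (x - a) y ≤ 1 := by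
    intro y
    have h1 : y ∈ B ↔ ∀ x ∈ s, inner ℝ (x - a) y ≤ 1 := by
      simp only [B, polyhedron, List.mem_map, Finset.mem_toList, forall_exists_index, and_imp,
        forall_apply_eq_imp_iff₂, Set.mem_ofPred_eq, innerₗ_apply_apply]
    rw [h1]
    constructor
    · intro h x hx
      have hsub : A ⊆ {x | innerₗ E y x ≤ 1 + inner ℝ a y} := by
        rw [hs]
        refine convexHull_min (fun x hx => ?_) (convex_setOf_le _ _)
        have := h x hx
        rw [inner_sub_left] at this
        simp only [Set.mem_ofPred_eq, innerₗ_apply_apply, real_inner_comm x y]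
        linarith
      have := hsub hx
      simp only [Set.mem_ofPred_eq, innerₗ_apply_apply, real_inner_comm x y] at this
      rw [inner_sub_left]
      linarith
    · intro h x hx
      exact h x (hs ▸ subset_convexHull ℝ _ hx)
  have hBbdd : Bornology.IsBounded B := by
    refine isBounded_iff_forall_norm_le.2 ⟨2 / ε, fun y hy => ?_⟩
    rcases eq_or_ne y 0 with rfl | hy0
    · simp; positivity
    have hn : 0 < ‖y‖ := norm_pos_iff.2 hy0
    have := (hBmem y).1 hy (a + (ε / 2 / ‖y‖) • y) (hball (by
      rw [Metric.mem_ball, dist_self_add_left, norm_smul, Real.norm_of_nonneg (by positivity),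
        div_mul_cancel₀ _ hn.ne']
      linarith))
    rw [add_sub_cancel_left, inner_smul_left, real_inner_self_eq_norm_sq] at this
    simp only [conj_trivial] at this
    rw [le_div_iff₀ hε]
    have e : ε / 2 / ‖y‖ * ‖y‖ ^ 2 = ε / 2 * ‖y‖ := by field_simp
    rw [e] at this
    linarith
  obtain ⟨K, hK, hBK⟩ := exists_isHull_superset hBbdd
  have hBhull : IsHull B := by
    have := hK.inter_polyhedron (s.toList.map fun x => (innerₗ E (x - a), (1 : ℝ)))
    rwa [Set.inter_eq_right.2 hBK] at this
  obtain ⟨r, hr⟩ := hBhull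
  -- The point `0` of the polar gives only the trivial constraint `0 ≤ 1`; dropping it keeps every
  -- functional nonzero.
  refine ⟨(r.erase 0).toList.map fun y => (innerₗ E y, 1 + inner ℝ y a), ?_, ?_⟩
  · simp only [List.mem_map, Finset.mem_toList, Finset.mem_erase, forall_exists_index, and_imp]
    rintro p y hy0 - rfl h
    have := LinearMap.congr_fun h y
    simp [hy0] at this
  · have hmem : ∀ x, x ∈ polyhedron ((r.erase 0).toList.map fun y => (innerₗ E y, 1 + inner ℝ y a))
        ↔ ∀ y ∈ r, inner ℝ y (x - a) ≤ 1 := by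
      intro x
      simp only [polyhedron, List.mem_map, Finset.mem_toList, Finset.mem_erase,
        forall_exists_index, and_imp, Set.mem_ofPred_eq]
      constructor
      · intro h y hy
        rcases eq_or_ne y 0 with rfl | hy0
        · simp
        · have := h _ y hy0 hy rfl
          simp only [innerₗ_apply_apply] at this
          rw [inner_sub_right]; linarith
      · rintro h p y hy0 hy rfl
        have := h y hy
        rw [inner_sub_right] at this
        simp only [innerₗ_apply_apply]
        linarith
    ext x
    rw [hmem]
    constructor
    · intro hx y hy
      have hyB : y ∈ B := hr ▸ subset_convexHull ℝ _ hy
      rw [real_inner_comm]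
      exact (hBmem y).1 hyB x hx
    · intro h
      by_contra hxA
      -- A functional separating `x` from `A`, normalised to have the value `1` at distance `u - f
      -- a` above `a`, is a point of the polar that excludes `x`.
      obtain ⟨f, u, hfA, hfx⟩ := geometric_hahn_banach_closed_point hAconv hAcl hxA
      have hfa := hfA a (interior_subset ha)
      obtain ⟨y₀, hy₀⟩ := (InnerProductSpace.toDual ℝ E).surjective f
      have hfy : ∀ x, f x = inner ℝ y₀ x := fun x => by
        rw [← hy₀, InnerProductSpace.toDual_apply_apply]
      have hpos : 0 < u - f a := by linarith
      have hyB : (u - f a)⁻¹ • y₀ ∈ B := by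
        rw [hBmem]
        intro x hx
        have := hfA x hx
        rw [inner_smul_right, real_inner_comm, inner_sub_right, ← hfy, ← hfy, inv_mul_le_iff₀ hpos]
        linarith
      have hle : B ⊆ {y | innerₗ E (x - a) y ≤ 1} := by
        rw [hr]
        refine convexHull_min (fun y hy => ?_) (convex_setOf_le _ _)
        have := h y hy
        rw [real_inner_comm] at this
        simpa only [Set.mem_ofPred_eq, innerₗ_apply_apply] using this
      have := hle hyB
      simp only [Set.mem_ofPred_eq, innerₗ_apply_apply] at this
      rw [inner_smul_right, real_inner_comm, inner_sub_right, ← hfy, ← hfy,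
        inv_mul_le_iff₀ hpos] at this
      linarith

end Representation

/-! ### Simplices with a vertex at the origin, and dissections -/

/-- The convex hull of the origin and the points of a family. -/
def cornerSimplex {E ι : Type*} [AddCommGroup E] [Module ℝ E] (x : ι → E) : Set E :=
  convexHull ℝ (insert 0 (Set.range x))

section Corner

variable {E ι : Type*} [AddCommGroup E] [Module ℝ E]

theorem zero_mem_cornerSimplex (x : ι → E) : (0 : E) ∈ cornerSimplex x :=
  subset_convexHull ℝ _ (Set.mem_insert _ _)

theorem mem_cornerSimplex_self (x : ι → E) (i : ι) : x i ∈ cornerSimplex x :=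
  subset_convexHull ℝ _ (Set.mem_insert_of_mem _ ⟨i, rfl⟩)

theorem convex_cornerSimplex (x : ι → E) : Convex ℝ (cornerSimplex x) := convex_convexHull ℝ _

theorem cornerSimplex_subset {x : ι → E} {K : Set E} (hK : Convex ℝ K) (h0 : (0 : E) ∈ K)
    (h : ∀ i, x i ∈ K) : cornerSimplex x ⊆ K :=
  convexHull_min (Set.insert_subset h0 (Set.range_subset_iff.2 h)) hK

theorem cornerSimplex_comp_equiv (x : ι → E) (σ : Equiv.Perm ι) :
    cornerSimplex (x ∘ σ) = cornerSimplex x := by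
  rw [cornerSimplex, cornerSimplex, EquivLike.range_comp]

theorem image_cornerSimplex {F : Type*} [AddCommGroup F] [Module ℝ F] (f : E →ₗ[ℝ] F) (x : ι → E) :
    f '' cornerSimplex x = cornerSimplex (f ∘ x) := by
  rw [cornerSimplex, cornerSimplex, f.image_convexHull, Set.image_insert_eq, map_zero,
    Set.range_comp]

theorem linearIndependent_update_of_sum [DecidableEq ι] {x : ι → E} (hx : LinearIndependent ℝ x)
    {i j : ι} (hij : i ≠ j) {a b : ℝ} (ha : a ≠ 0) :
    LinearIndependent ℝ (Function.update x i (a • x i + b • x j)) := by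
  refine hx.update i _ ⟨1, one_mem _, Finsupp.single i a + Finsupp.single j b, ?_, ?_⟩
  · rw [mem_nonZeroDivisors_iff_ne_zero]
    simpa [hij.symm] using ha
  · simp [map_add, Finsupp.linearCombination_single]

variable [Fintype ι]

theorem isHull_cornerSimplex (x : ι → E) : IsHull (cornerSimplex x) := by
  classical
  exact ⟨insert 0 (Finset.univ.image x), by simp [cornerSimplex]⟩

theorem sum_smul_mem_cornerSimplex {x : ι → E} {t : ι → ℝ} (h0 : ∀ i, 0 ≤ t i)
    (h1 : ∑ i, t i ≤ 1) : ∑ i, t i • x i ∈ cornerSimplex x := by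
  refine mem_convexHull_of_exists_fintype (ι := Option ι)
    (fun o => o.elim (1 - ∑ i, t i) t) (fun o => o.elim 0 x) ?_ ?_ ?_ ?_
  · rintro (_ | i)
    · simpa using h1
    · exact h0 i
  · simp [Fintype.sum_option]
  · rintro (_ | i)
    · exact Set.mem_insert _ _
    · exact Set.mem_insert_of_mem _ ⟨i, rfl⟩
  · simp [Fintype.sum_option]

theorem mem_cornerSimplex {x : ι → E} {y : E} :
    y ∈ cornerSimplex x ↔ ∃ t : ι → ℝ, (∀ i, 0 ≤ t i) ∧ ∑ i, t i ≤ 1 ∧ ∑ i, t i • x i = y := by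
  classical
  constructor
  · have hconv : Convex ℝ {y | ∃ t : ι → ℝ, (∀ i, 0 ≤ t i) ∧ ∑ i, t i ≤ 1 ∧
        ∑ i, t i • x i = y} := by
      rintro _ ⟨t, ht0, ht1, rfl⟩ _ ⟨u, hu0, hu1, rfl⟩ a b ha hb hab
      refine ⟨fun i => a * t i + b * u i, fun i => ?_, ?_, ?_⟩
      · have := ht0 i
        have := hu0 i
        positivity
      · rw [Finset.sum_add_distrib, ← Finset.mul_sum, ← Finset.mul_sum]
        nlinarith
      · simp only [add_smul, mul_smul, Finset.sum_add_distrib, Finset.smul_sum]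
    intro hy
    refine cornerSimplex_subset hconv ⟨0, by simp⟩ (fun i => ⟨Pi.single i 1, ?_, ?_, ?_⟩) hy
    · intro j
      rcases eq_or_ne j i with rfl | h
      · simp
      · simp [h]
    · simp
    · simp [Pi.single_apply]
  · rintro ⟨t, h0, h1, rfl⟩
    exact sum_smul_mem_cornerSimplex h0 h1

theorem sum_eq_add_add_sum_erase {M : Type*} [AddCommMonoid M] [DecidableEq ι] {i j : ι}
    (hij : i ≠ j) (F : ι → M) :
    ∑ k, F k = F i + (F j + ∑ k ∈ (Finset.univ.erase i).erase j, F k) := by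
  rw [Finset.add_sum_erase _ _ (Finset.mem_erase.2 ⟨hij.symm, Finset.mem_univ _⟩),
    Finset.add_sum_erase _ _ (Finset.mem_univ _)]

/-- Cutting a simplex with a vertex at the origin through a point of the edge from `x i` to `x j`
and all the other vertices. -/
theorem cornerSimplex_inter_le [DecidableEq ι] (x : ι → E) {i j : ι} (hij : i ≠ j) {l : ℝ}
    (hl0 : 0 < l) (hl1 : l < 1) (f : E →ₗ[ℝ] ℝ) (hi : f (x i) = l) (hj : f (x j) = -(1 - l))
    (hk : ∀ k, k ≠ i → k ≠ j → f (x k) = 0) :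
    cornerSimplex x ∩ {y | f y ≤ 0} =
      cornerSimplex (Function.update x i ((1 - l) • x i + l • x j)) := by
  have hl1' : 0 < 1 - l := by linarith
  refine Set.Subset.antisymm ?_ ?_
  · rintro y ⟨hy, hfy⟩
    obtain ⟨t, ht0, ht1, rfl⟩ := mem_cornerSimplex.1 hy
    have hf : l * t i ≤ (1 - l) * t j := by
      have h : f (∑ k, t k • x k) ≤ 0 := hfy
      rw [sum_eq_add_add_sum_erase hij, map_add, map_add, map_sum] at h
      rw [Finset.sum_eq_zero (s := (Finset.univ.erase i).erase j)] at h
      · simp only [map_smul, hi, hj, smul_eq_mul] at h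
        linarith
      · intro k hk'
        simp only [Finset.mem_erase, Finset.mem_univ, and_true] at hk'
        rw [map_smul, hk k hk'.2 hk'.1, smul_zero]
    -- Coordinates of the same point after `x i` is replaced by the cut point; the halfspace
    -- condition is exactly nonnegativity of the `j`-th one.
    let u : ι → ℝ := Function.update (Function.update t i (t i / (1 - l))) j
      (t j - l * t i / (1 - l))
    have hui : u i = t i / (1 - l) := by simp [u, hij]
    have huj : u j = t j - l * t i / (1 - l) := by simp [u]
    have huk : ∀ k ∈ (Finset.univ.erase i).erase j, u k = t k := by
      intro k hk'
      simp only [Finset.mem_erase, Finset.mem_univ, and_true] at hk'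
      simp [u, hk'.1, hk'.2]
    refine mem_cornerSimplex.2 ⟨u, fun k => ?_, ?_, ?_⟩
    · by_cases h1 : k = j
      · rw [h1, huj, sub_nonneg, div_le_iff₀ hl1']
        linarith
      · by_cases h2 : k = i
        · rw [h2, hui]
          exact div_nonneg (ht0 i) hl1'.le
        · rw [huk k (by simp [h1, h2])]
          exact ht0 k
    · refine le_of_eq_of_le ?_ ht1
      rw [sum_eq_add_add_sum_erase hij, sum_eq_add_add_sum_erase hij t, hui, huj,
        Finset.sum_congr rfl huk]
      field_simp
      ring
    · rw [sum_eq_add_add_sum_erase hij, sum_eq_add_add_sum_erase hij (fun k => t k • x k), hui, huj]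
      rw [Finset.sum_congr rfl (g := fun k => t k • x k)]
      · rw [Function.update_self, Function.update_of_ne hij.symm, ← add_assoc, ← add_assoc]
        congr 1
        rw [smul_add, smul_smul, smul_smul, add_assoc, ← add_smul]
        congr 2 <;> field_simp
        ring
      · intro k hk'
        rw [huk k hk']
        simp only [Finset.mem_erase, Finset.mem_univ, and_true] at hk'
        rw [Function.update_of_ne hk'.2]
  · refine cornerSimplex_subset ((convex_cornerSimplex x).inter (convex_setOf_le f 0))
      ⟨zero_mem_cornerSimplex x, by simp⟩ fun k => ?_
    by_cases h2 : k = i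
    · subst h2
      rw [Function.update_self]
      refine ⟨convex_cornerSimplex x (mem_cornerSimplex_self x k) (mem_cornerSimplex_self x j)
        hl1'.le hl0.le (by ring), ?_⟩
      rw [Set.mem_ofPred_eq]
      refine le_of_eq ?_
      rw [map_add, map_smul, map_smul, hi, hj, smul_eq_mul, smul_eq_mul]
      ring
    · rw [Function.update_of_ne h2]
      refine ⟨mem_cornerSimplex_self x k, ?_⟩
      rw [Set.mem_ofPred_eq]
      by_cases h1 : k = j
      · rw [h1, hj]; linarith
      · rw [hk k h2 h1]

theorem cornerSimplex_inter_ge [DecidableEq ι] (x : ι → E) {i j : ι} (hij : i ≠ j) {l : ℝ}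
    (hl0 : 0 < l) (hl1 : l < 1) (f : E →ₗ[ℝ] ℝ) (hi : f (x i) = l) (hj : f (x j) = -(1 - l))
    (hk : ∀ k, k ≠ i → k ≠ j → f (x k) = 0) :
    cornerSimplex x ∩ {y | 0 ≤ f y} =
      cornerSimplex (Function.update x j ((1 - l) • x i + l • x j)) := by
  have := cornerSimplex_inter_le x hij.symm (l := 1 - l) (by linarith) (by linarith) (-f)
    (by simp [hj]) (by simp [hi]) (fun k h1 h2 => by simp [hk k h2 h1])
  simpa [add_comm] using this

/-- The values are chosen so that the hyperplane `f = 0` contains the origin, the point `(1 - l) • x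
i + l • x j` and all the other vertices. -/
theorem exists_edge_functional [DecidableEq ι] {x : ι → E} (hx : LinearIndependent ℝ x)
    (hcard : Fintype.card ι = Module.finrank ℝ E) {i j : ι} (hij : i ≠ j) {l : ℝ} (hl0 : 0 < l) :
    ∃ f : E →ₗ[ℝ] ℝ, f ≠ 0 ∧ f (x i) = l ∧ f (x j) = -(1 - l) ∧
      ∀ k, k ≠ i → k ≠ j → f (x k) = 0 := by
  have : Nonempty ι := ⟨i⟩
  let b := basisOfLinearIndependentOfCardEqFinrank hx hcard
  have hb : ∀ k, x k = b k := fun k => by simp [b]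
  let f : E →ₗ[ℝ] ℝ := l • b.coord i - (1 - l) • b.coord j
  have hfi : f (x i) = l := by simp [f, hb, hij]
  refine ⟨f, fun h => ?_, hfi, by simp [f, hb, hij.symm], fun k h1 h2 => ?_⟩
  · rw [h, LinearMap.zero_apply] at hfi
    exact hl0.ne hfi
  · simp [f, hb, h1, h2]

end Corner

/-! ### Reduction of arbitrary polytopes to simplices with a vertex at the origin. -/

section Dissection

variable {E : Type*} [AddCommGroup E] [Module ℝ E]

/-- A set function that is additive under cutting a polytope by a hyperplane and vanishes on
polytopes contained in a hyperplane. -/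
structure IsDissective (N : Set E → ℝ) : Prop where
  cut : ∀ A, IsHull A → ∀ f : E →ₗ[ℝ] ℝ, f ≠ 0 → ∀ c,
    N A = N (A ∩ {x | f x ≤ c}) + N (A ∩ {x | c ≤ f x})
  flat : ∀ A, IsHull A → ∀ f : E →ₗ[ℝ] ℝ, f ≠ 0 → ∀ c, (∀ x ∈ A, f x = c) → N A = 0

variable {N : Set E → ℝ} {ι : Type*} [Fintype ι]

theorem IsDissective.edge_cut [DecidableEq ι] (hN : IsDissective N) {x : ι → E}
    (hx : LinearIndependent ℝ x) (hcard : Fintype.card ι = Module.finrank ℝ E) {i j : ι}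
    (hij : i ≠ j) {l : ℝ} (hl0 : 0 < l) (hl1 : l < 1) {Q : Set E}
    (hQ : IsHull (cornerSimplex x ∩ Q)) :
    N (cornerSimplex x ∩ Q) =
      N (cornerSimplex (Function.update x i ((1 - l) • x i + l • x j)) ∩ Q) +
      N (cornerSimplex (Function.update x j ((1 - l) • x i + l • x j)) ∩ Q) := by
  obtain ⟨f, hf, hi, hj, hk⟩ := exists_edge_functional hx hcard hij hl0
  rw [hN.cut _ hQ f hf 0, Set.inter_right_comm, Set.inter_right_comm _ Q,
    cornerSimplex_inter_le x hij hl0 hl1 f hi hj hk,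
    cornerSimplex_inter_ge x hij hl0 hl1 f hi hj hk]

theorem cornerSimplex_inter_le_of_le (x : ι → E) (f : E →ₗ[ℝ] ℝ) {c : ℝ} (hc : 0 < c)
    (h : ∀ i, c ≤ f (x i)) :
    cornerSimplex x ∩ {y | f y ≤ c} = cornerSimplex fun i => (c / f (x i)) • x i := by
  have hpos : ∀ i, 0 < f (x i) := fun i => hc.trans_le (h i)
  refine Set.Subset.antisymm ?_ ?_
  · rintro y ⟨hy, hfy⟩
    obtain ⟨t, ht0, ht1, rfl⟩ := mem_cornerSimplex.1 hy
    refine mem_cornerSimplex.2 ⟨fun i => t i * (f (x i) / c), fun i => ?_, ?_, ?_⟩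
    · exact mul_nonneg (ht0 i) (div_nonneg (hpos i).le hc.le)
    · have h' : f (∑ i, t i • x i) ≤ c := hfy
      simp only [map_sum, map_smul, smul_eq_mul] at h'
      simp only [← mul_div_assoc]
      rw [← Finset.sum_div]
      exact (div_le_one hc).2 h'
    · refine Finset.sum_congr rfl fun i _ => ?_
      rw [smul_smul]
      congr 1
      have := (hpos i).ne'
      field_simp
  · refine cornerSimplex_subset ((convex_cornerSimplex x).inter (convex_setOf_le f c))
      ⟨zero_mem_cornerSimplex x, by simpa using hc.le⟩ fun i => ⟨?_, ?_⟩
    · exact (convex_cornerSimplex x).smul_mem_of_zero_mem (zero_mem_cornerSimplex x)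
        (mem_cornerSimplex_self x i) ⟨div_nonneg hc.le (hpos i).le, (div_le_one (hpos i)).2 (h i)⟩
    · rw [Set.mem_ofPred_eq, map_smul, smul_eq_mul, div_mul_cancel₀ _ (hpos i).ne']

/-- Induction on the number of vertices off the hyperplane `f = c`. If an edge crosses it, cutting
the simplex at the crossing point gives two simplices with fewer such vertices. If none does, the
simplex lies in the halfspace (which contains the origin, as `c ≥ 0`), or all vertices have `f ≥ c`.
In the latter case the truncated simplex is again a corner simplex when `c > 0`, and the section is
flat when `c = 0`. -/
theorem IsDissective.halfspace_eq_zero (hN : IsDissective N)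
    (hcard : Fintype.card ι = Module.finrank ℝ E) (T : List ((E →ₗ[ℝ] ℝ) × ℝ))
    (hT : ∀ x : ι → E, LinearIndependent ℝ x → N (cornerSimplex x ∩ polyhedron T) = 0)
    (f : E →ₗ[ℝ] ℝ) (hf : f ≠ 0) {c : ℝ} (hc : 0 ≤ c) (x : ι → E) (hx : LinearIndependent ℝ x) :
    N (cornerSimplex x ∩ (polyhedron T ∩ {y | f y ≤ c})) = 0 := by
  classical
  induction hm : (Finset.univ.filter fun i => f (x i) ≠ c).card using Nat.strong_induction_on
    generalizing x with
  | _ m ih =>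
  subst hm
  have hhull : ∀ x : ι → E, IsHull (cornerSimplex x ∩ (polyhedron T ∩ {y | f y ≤ c})) := by
    intro x
    rw [← Set.inter_assoc]
    exact ((isHull_cornerSimplex x).inter_polyhedron T).inter_le f c
  by_cases hex : ∃ i j, f (x i) < c ∧ c < f (x j)
  · obtain ⟨i, j, hi, hj⟩ := hex
    have hij : i ≠ j := by rintro rfl; linarith
    have hgap : 0 < f (x j) - f (x i) := by linarith
    set l := (c - f (x i)) / (f (x j) - f (x i)) with hl
    have hl0 : 0 < l := div_pos (by linarith) hgap
    have hl1 : l < 1 := (div_lt_one hgap).2 (by linarith)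
    have hz : f ((1 - l) • x i + l • x j) = c := by
      rw [map_add, map_smul, map_smul, smul_eq_mul, smul_eq_mul, hl]
      field_simp
      ring
    have hlt : ∀ k, f (x k) ≠ c →
        (Finset.univ.filter fun i' =>
          f (Function.update x k ((1 - l) • x i + l • x j) i') ≠ c).card <
        (Finset.univ.filter fun i => f (x i) ≠ c).card := by
      intro k hk
      refine Finset.card_lt_card (Finset.ssubset_iff_subset_ne.2 ⟨fun i' => ?_, fun h => ?_⟩)
      · simp only [Finset.mem_filter, Finset.mem_univ, true_and]
        by_cases h : i' = k
        · subst h; simp [hz]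
        · rw [Function.update_of_ne h]; exact id
      · have : k ∈ Finset.univ.filter fun i => f (x i) ≠ c := by simp [hk]
        rw [← h] at this
        simp [hz] at this
    rw [hN.edge_cut hx hcard hij hl0 hl1 (hhull x),
      ih _ (hlt i hi.ne) _ (linearIndependent_update_of_sum hx hij (by linarith)) rfl,
      ih _ (hlt j hj.ne') _ ?_ rfl, add_zero]
    rw [add_comm]
    exact linearIndependent_update_of_sum hx hij.symm hl0.ne'
  · push Not at hex
    by_cases hle : ∀ i, f (x i) ≤ c
    · have hsub : cornerSimplex x ⊆ {y | f y ≤ c} :=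
        cornerSimplex_subset (convex_setOf_le f c) (by simpa using hc) hle
      rw [Set.inter_left_comm, Set.inter_eq_left.2 hsub, Set.inter_comm]
      exact hT x hx
    · push Not at hle
      obtain ⟨j, hj⟩ := hle
      have hge : ∀ i, c ≤ f (x i) := fun i => by
        by_contra h
        have := hex i j (not_le.1 h)
        linarith
      rcases hc.eq_or_lt with rfl | hc
      · refine hN.flat _ (hhull x) f hf 0 fun y hy => le_antisymm hy.2.2 ?_
        obtain ⟨t, ht0, -, rfl⟩ := mem_cornerSimplex.1 hy.1
        rw [map_sum]
        refine Finset.sum_nonneg fun i _ => ?_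
        rw [map_smul]
        exact mul_nonneg (ht0 i) (hge i)
      · rw [← Set.inter_assoc, Set.inter_right_comm, cornerSimplex_inter_le_of_le x f hc hge]
        have hpos : ∀ i, c / f (x i) ≠ 0 := fun i => (div_pos hc (hc.trans_le (hge i))).ne'
        refine hT _ ?_
        exact hx.units_smul fun i => Units.mk0 _ (hpos i)

/-- Halfspaces are imposed one at a time. One that misses the origin is the complement, up to its
boundary, of one that contains it, so its part is obtained by subtraction. -/
theorem IsDissective.corner_inter_polyhedron_eq_zero (hN : IsDissective N)
    (hcard : Fintype.card ι = Module.finrank ℝ E)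
    (h0 : ∀ x : ι → E, LinearIndependent ℝ x → N (cornerSimplex x) = 0)
    (T : List ((E →ₗ[ℝ] ℝ) × ℝ)) (hT : ∀ p ∈ T, p.1 ≠ 0) (x : ι → E)
    (hx : LinearIndependent ℝ x) : N (cornerSimplex x ∩ polyhedron T) = 0 := by
  induction T generalizing x with
  | nil => simpa [polyhedron_nil] using h0 x hx
  | cons p T ih =>
    have ih' := ih fun q hq => hT q (List.mem_cons_of_mem _ hq)
    have hp : p.1 ≠ 0 := hT p List.mem_cons_self
    rw [polyhedron_cons]
    rcases le_or_gt 0 p.2 with hc | hc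
    · exact hN.halfspace_eq_zero hcard T ih' p.1 hp hc x hx
    · have h1 := hN.halfspace_eq_zero hcard T ih' (-p.1) (neg_ne_zero.2 hp) (c := -p.2)
        (by linarith) x hx
      have h2 := hN.cut _ ((isHull_cornerSimplex x).inter_polyhedron T) p.1 hp p.2
      rw [ih' x hx] at h2
      simp only [LinearMap.neg_apply, neg_le_neg_iff] at h1
      rw [← Set.inter_assoc] at h1 ⊢
      linarith

end Dissection

section Euclidean

variable {E : Type*} [NormedAddCommGroup E] [InnerProductSpace ℝ E] [FiniteDimensional ℝ E]

theorem exists_flat_of_interior_eq_empty {A : Set E} (hA : Convex ℝ A) (h : interior A = ∅)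
    (hne : A.Nonempty) : ∃ f : E →ₗ[ℝ] ℝ, f ≠ 0 ∧ ∃ c, ∀ x ∈ A, f x = c := by
  obtain ⟨a, ha⟩ := hne
  have hspan : affineSpan ℝ A ≠ ⊤ := by
    rw [Ne, ← hA.interior_nonempty_iff_affineSpan_eq_top, h]
    exact Set.not_nonempty_empty
  have hdir : vectorSpan ℝ A < ⊤ := by
    rw [lt_top_iff_ne_top]
    intro h'
    exact hspan ((AffineSubspace.affineSpan_eq_top_iff_vectorSpan_eq_top_of_nonempty ℝ E E
      ⟨a, ha⟩).2 h')
  obtain ⟨f, hf, hmap⟩ := Submodule.exists_le_ker_of_lt_top _ hdir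
  refine ⟨f, hf, f a, fun x hx => ?_⟩
  have := hmap (vsub_mem_vectorSpan ℝ hx ha)
  rw [LinearMap.mem_ker, vsub_eq_sub, map_sub, sub_eq_zero] at this
  exact this

/-- A dissective set function vanishing on all nondegenerate simplices with a vertex at the origin
vanishes on all polytopes. -/
theorem IsDissective.eq_zero {N : Set E → ℝ} (hN : IsDissective N) {ι : Type*} [Fintype ι]
    [Nonempty ι] (hcard : Fintype.card ι = Module.finrank ℝ E)
    (h0 : ∀ x : ι → E, LinearIndependent ℝ x → N (cornerSimplex x) = 0) {A : Set E}
    (hA : IsHull A) : N A = 0 := by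
  classical
  let b : OrthonormalBasis ι ℝ E := (stdOrthonormalBasis ℝ E).reindex
    (Fintype.equivFinOfCardEq hcard).symm
  have hcoord : ∀ i, (b.toBasis.coord i) ≠ 0 := fun i h => by
    have := LinearMap.congr_fun h (b i)
    simp at this
  -- `J` collects the coordinates that may change sign on `A`. Cutting along coordinate hyperplanes
  -- empties it; then `A` lies in one orthant and hence inside a large corner simplex.
  suffices H : ∀ (J : Finset ι) (A : Set E), IsHull A →
      (∀ i ∉ J, (∀ y ∈ A, 0 ≤ b.toBasis.coord i y) ∨ ∀ y ∈ A, b.toBasis.coord i y ≤ 0) →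
      N A = 0 from H Finset.univ A hA (by simp)
  intro J
  induction J using Finset.induction_on with
  | empty =>
    intro A hA hsign
    have hflat : interior A = ∅ → N A = 0 := by
      intro hint
      rcases A.eq_empty_or_nonempty with rfl | hne
      · obtain ⟨i⟩ := ‹Nonempty ι›
        exact hN.flat _ hA _ (hcoord i) 0 (by simp)
      · obtain ⟨f, hf, c, hc⟩ := exists_flat_of_interior_eq_empty hA.convex hint hne
        exact hN.flat _ hA f hf c hc
    rcases (interior A).eq_empty_or_nonempty with hint | hint
    · exact hflat hint
    obtain ⟨T, hT, hAT⟩ := hA.exists_polyhedron hint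
    have hε : ∀ i, ∃ ε : ℝ, ε ≠ 0 ∧ ε * ε = 1 ∧ ∀ y ∈ A, 0 ≤ ε * b.toBasis.coord i y := by
      intro i
      rcases hsign i (Finset.notMem_empty i) with h | h
      · exact ⟨1, one_ne_zero, by norm_num, fun y hy => by linarith [h y hy]⟩
      · exact ⟨-1, by norm_num, by norm_num, fun y hy => by linarith [h y hy]⟩
    choose ε hε0 hε2 hε using hε
    obtain ⟨R, hR0, hR⟩ := hA.isCompact.isBounded.exists_pos_norm_le
    have hR1 : (0 : ℝ) < Fintype.card ι * R := by
      have : 0 < Fintype.card ι := Fintype.card_pos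
      positivity
    -- Each coordinate is at most `R` in absolute value, so their sum is at most `M`.
    set M := Fintype.card ι * R
    let x : ι → E := fun i => (M * ε i) • b i
    have hxli : LinearIndependent ℝ x :=
      b.orthonormal.linearIndependent.units_smul fun i =>
        Units.mk0 (M * ε i) (mul_ne_zero hR1.ne' (hε0 i))
    have hsub : A ⊆ cornerSimplex x := by
      intro y hy
      refine mem_cornerSimplex.2 ⟨fun i => ε i * b.toBasis.coord i y / M, fun i => ?_, ?_, ?_⟩
      · exact div_nonneg (hε i y hy) hR1.le
      · rw [← Finset.sum_div, div_le_one hR1]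
        have : ∀ i ∈ Finset.univ, ε i * b.toBasis.coord i y ≤ R := by
          intro i _
          have h1 : |ε i| = 1 := by
            have : |ε i| * |ε i| = 1 := by rw [abs_mul_abs_self, hε2 i]
            nlinarith [abs_nonneg (ε i)]
          calc ε i * b.toBasis.coord i y ≤ |ε i * b.toBasis.coord i y| := le_abs_self _
            _ = |inner ℝ (b i) y| := by
              rw [abs_mul, h1, one_mul, Module.Basis.coord_apply,
                OrthonormalBasis.coe_toBasis_repr_apply,
                OrthonormalBasis.repr_apply_apply]
            _ ≤ ‖b i‖ * ‖y‖ := abs_real_inner_le_norm _ _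
            _ ≤ R := by rw [b.orthonormal.1 i, one_mul]; exact hR y hy
        calc _ ≤ ∑ _i : ι, R := Finset.sum_le_sum this
          _ = M := by simp [M]
      · conv_rhs => rw [← b.toBasis.sum_repr y]
        refine Finset.sum_congr rfl fun i _ => ?_
        simp only [x, smul_smul, OrthonormalBasis.coe_toBasis, Module.Basis.coord_apply]
        congr 1
        have := hR1.ne'
        field_simp
        linear_combination (b.toBasis.repr y i) * hε2 i
    have hAeq : A = cornerSimplex x ∩ polyhedron T := by
      rw [← hAT, Set.inter_eq_right.2 hsub]
    rw [hAeq]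
    exact hN.corner_inter_polyhedron_eq_zero hcard h0 T hT x hxli
  | insert i J _ ih =>
    intro A hA hsign
    rw [hN.cut A hA (b.toBasis.coord i) (hcoord i) 0,
      ih _ (hA.inter_le _ _), ih _ (hA.inter_ge _ _), add_zero]
    · intro k hk
      by_cases hki : k = i
      · subst hki; exact Or.inl fun y hy => hy.2
      · exact (hsign k (by simp [hk, hki])).imp (fun h y hy => h y hy.1) fun h y hy => h y hy.1
    · intro k hk
      by_cases hki : k = i
      · subst hki; exact Or.inr fun y hy => hy.2
      · exact (hsign k (by simp [hk, hki])).imp (fun h y hy => h y hy.1) fun h y hy => h y hy.1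

end Euclidean

/-! ### Faces of polytopes -/

namespace ConvexPolytope

open MeasureTheory

variable {n : ℕ}

theorem isHull (P : ConvexPolytope n) : IsHull P.carrier :=
  let ⟨s, _, h⟩ := P.exists_finset'
  ⟨s, h⟩

theorem nonempty (P : ConvexPolytope n) : P.carrier.Nonempty := by
  obtain ⟨s, hs, h⟩ := P.exists_finset'
  rw [h]
  exact (Finset.coe_nonempty.2 hs).convexHull

theorem exists_carrier_eq {A : Set (EuclideanSpace ℝ (Fin n))} (hA : IsHull A)
    (hne : A.Nonempty) : ∃ P : ConvexPolytope n, P.carrier = A := by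
  obtain ⟨s, rfl⟩ := hA
  exact ⟨⟨_, s, by simpa using hne, rfl⟩, rfl⟩

theorem bddAbove_inner (P : ConvexPolytope n) (v : EuclideanSpace ℝ (Fin n)) :
    BddAbove ((fun x => inner ℝ x v) '' P.carrier) :=
  (P.isHull.isCompact.image (by fun_prop)).bddAbove

theorem inner_le_supp (P : ConvexPolytope n) (v : EuclideanSpace ℝ (Fin n))
    {x : EuclideanSpace ℝ (Fin n)} (hx : x ∈ P.carrier) : inner ℝ x v ≤ P.supp v :=
  le_csSup (P.bddAbove_inner v) ⟨x, hx, rfl⟩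

theorem face_nonempty (P : ConvexPolytope n) (v : EuclideanSpace ℝ (Fin n)) :
    (P.face v).Nonempty := by
  obtain ⟨x, hx, h⟩ := (P.isHull.isCompact.image
    (f := fun x : EuclideanSpace ℝ (Fin n) => (inner ℝ x v : ℝ)) (by fun_prop)).sSup_mem
    (P.nonempty.image _)
  exact ⟨x, hx, h⟩

theorem supp_eq_of_mem {P : ConvexPolytope n} {v x : EuclideanSpace ℝ (Fin n)}
    (hx : x ∈ P.carrier) (h : ∀ y ∈ P.carrier, inner ℝ y v ≤ inner ℝ x v) :
    P.supp v = inner ℝ x v := by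
  obtain ⟨y, hy, hyv⟩ := P.face_nonempty v
  exact le_antisymm (hyv ▸ h y hy) (P.inner_le_supp v hx)

theorem face_subset (P : ConvexPolytope n) (v : EuclideanSpace ℝ (Fin n)) :
    P.face v ⊆ P.carrier := fun _ hx => hx.1

theorem convex_inner_eq (v : EuclideanSpace ℝ (Fin n)) (c : ℝ) :
    Convex ℝ {x : EuclideanSpace ℝ (Fin n) | inner ℝ x v = c} := by
  intro x hx y hy a b _ _ hab
  simp only [Set.mem_ofPred_eq] at hx hy ⊢
  rw [inner_add_left, inner_smul_left, inner_smul_left, hx, hy, conj_trivial, conj_trivial,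
    ← add_mul, hab, one_mul]

theorem face_eq_inter (P : ConvexPolytope n) (v : EuclideanSpace ℝ (Fin n)) :
    P.face v = P.carrier ∩ {x | inner ℝ x v = P.supp v} := rfl

theorem convex_face (P : ConvexPolytope n) (v : EuclideanSpace ℝ (Fin n)) :
    Convex ℝ (P.face v) :=
  P.isHull.convex.inter (convex_inner_eq v _)

theorem isClosed_inner_eq (v : EuclideanSpace ℝ (Fin n)) (c : ℝ) :
    IsClosed {x : EuclideanSpace ℝ (Fin n) | inner ℝ x v = c} :=
  isClosed_eq (by fun_prop) (by fun_prop)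

theorem isClosed_face (P : ConvexPolytope n) (v : EuclideanSpace ℝ (Fin n)) :
    IsClosed (P.face v) :=
  P.isHull.isCompact.isClosed.inter (isClosed_inner_eq v _)

theorem vectorSpan_le_orthogonal {K : Set (EuclideanSpace ℝ (Fin n))}
    {v : EuclideanSpace ℝ (Fin n)} {c : ℝ} (h : ∀ x ∈ K, inner ℝ x v = c) :
    vectorSpan ℝ K ≤ (Submodule.span ℝ {v})ᗮ := by
  refine Submodule.span_le.2 ?_
  rintro _ ⟨x, hx, y, hy, rfl⟩
  rw [SetLike.mem_coe, Submodule.mem_orthogonal_singleton_iff_inner_left]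
  simp only [vsub_eq_sub]
  rw [inner_sub_left, h x hx, h y hy, sub_self]

theorem linearIndependent_pair_of_norm_eq_one {E : Type*} [NormedAddCommGroup E] [NormedSpace ℝ E]
    {v w : E} (hv : ‖v‖ = 1) (hw : ‖w‖ = 1) (h1 : w ≠ v) (h2 : w ≠ -v) :
    LinearIndependent ℝ ![v, w] := by
  rw [LinearIndependent.pair_iff' (norm_ne_zero_iff.1 (by rw [hv]; exact one_ne_zero))]
  intro a ha
  have : |a| = 1 := by
    have := congrArg norm ha
    rwa [norm_smul, hv, hw, mul_one, Real.norm_eq_abs] at this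
  rcases eq_or_eq_neg_of_abs_eq this with rfl | rfl
  · exact h1 (by rw [← ha, one_smul])
  · exact h2 (by rw [← ha, neg_one_smul])

/-- Two independent normals cost two dimensions. This is why overlaps of pieces and degenerate faces
are null for `(n - 1)`-dimensional volume. -/
theorem finrank_vectorSpan_add_two_le {K : Set (EuclideanSpace ℝ (Fin n))}
    {v w : EuclideanSpace ℝ (Fin n)} (hv : ‖v‖ = 1) (hw : ‖w‖ = 1) (h1 : w ≠ v) (h2 : w ≠ -v)
    {c d : ℝ} (hKv : ∀ x ∈ K, inner ℝ x v = c) (hKw : ∀ x ∈ K, inner ℝ x w = d) :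
    Module.finrank ℝ (vectorSpan ℝ K) + 2 ≤ n := by
  have hle : vectorSpan ℝ K ≤ (Submodule.span ℝ (Set.range ![v, w]))ᗮ := by
    rw [Matrix.range_cons, Matrix.range_cons, Matrix.range_empty, Set.union_empty,
      Submodule.span_union, ← Submodule.inf_orthogonal]
    exact le_inf (vectorSpan_le_orthogonal hKv) (vectorSpan_le_orthogonal hKw)
  have h3 := finrank_span_eq_card (linearIndependent_pair_of_norm_eq_one hv hw h1 h2)
  have h4 := (Submodule.span ℝ (Set.range ![v, w])).finrank_add_finrank_orthogonal
  rw [finrank_euclideanSpace_fin, h3, Fintype.card_fin] at h4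
  have := Submodule.finrank_mono hle
  omega

/-- The Hausdorff dimension of a nonempty convex set is the dimension of its affine hull. -/
theorem euclideanHausdorffMeasure_eq_zero_of_convex {K : Set (EuclideanSpace ℝ (Fin n))}
    (hK : Convex ℝ K) {d : ℕ} (h : Module.finrank ℝ (vectorSpan ℝ K) < d) : μHE[d] K = 0 := by
  rcases K.eq_empty_or_nonempty with rfl | hne
  · simp
  have h1 : dimH K < ((d : NNReal) : ENNReal) := by
    rw [Real.Convex.dimH_eq_finrank_vectorSpan hK hne]
    exact_mod_cast h
  have h2 := hausdorffMeasure_of_dimH_lt h1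
  rw [Measure.euclideanHausdorffMeasure_def, Measure.smul_apply]
  simp only [NNReal.coe_natCast] at h2
  rw [h2, smul_zero]

theorem euclideanHausdorffMeasure_inter_eq_zero {v w : EuclideanSpace ℝ (Fin n)}
    (hv : ‖v‖ = 1) (hw : ‖w‖ = 1) (h1 : w ≠ v) (h2 : w ≠ -v) (c d : ℝ) :
    μHE[n - 1] {x : EuclideanSpace ℝ (Fin n) | inner ℝ x v = c ∧ inner ℝ x w = d} = 0 := by
  refine euclideanHausdorffMeasure_eq_zero_of_convex
    ((convex_inner_eq v c).inter (convex_inner_eq w d)) ?_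
  have := finrank_vectorSpan_add_two_le (K := {x | inner ℝ x v = c ∧ inner ℝ x w = d}) hv hw h1 h2
    (fun x hx => hx.1) (fun x hx => hx.2)
  change Module.finrank ℝ (vectorSpan ℝ {x | inner ℝ x v = c ∧ inner ℝ x w = d}) < n - 1
  omega

theorem finrank_orthogonal_singleton {v : EuclideanSpace ℝ (Fin n)} (hv : ‖v‖ = 1) :
    Module.finrank ℝ (Submodule.span ℝ {v})ᗮ = n - 1 := by
  have h0 : v ≠ 0 := norm_ne_zero_iff.1 (by rw [hv]; exact one_ne_zero)
  have h4 := (Submodule.span ℝ {v}).finrank_add_finrank_orthogonal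
  rw [finrank_span_singleton h0, finrank_euclideanSpace_fin] at h4
  omega

/-- A translate of `K` lies in the orthogonal complement of `v`, where the measure is Lebesgue
measure. Finiteness is what allows `toReal` to be additive. -/
theorem euclideanHausdorffMeasure_lt_top {K : Set (EuclideanSpace ℝ (Fin n))}
    (hK : Bornology.IsBounded K) {v : EuclideanSpace ℝ (Fin n)} (hv : ‖v‖ = 1) {c : ℝ}
    (h : ∀ x ∈ K, inner ℝ x v = c) : μHE[n - 1] K < ⊤ := by
  rcases K.eq_empty_or_nonempty with rfl | ⟨x₀, hx₀⟩
  · simp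
  let V := (Submodule.span ℝ {v})ᗮ
  let g : V → EuclideanSpace ℝ (Fin n) := fun y => x₀ + y
  have hg : Isometry g := (isometry_add_left x₀).comp isometry_subtype_coe
  have hKg : K ⊆ Set.range g := fun x hx => by
    refine ⟨⟨x - x₀, vectorSpan_le_orthogonal h (vsub_mem_vectorSpan ℝ hx hx₀)⟩, ?_⟩
    simp [g]
  rw [← Set.image_preimage_eq_of_subset hKg, hg.euclideanHausdorffMeasure_image,
    ← finrank_orthogonal_singleton hv, InnerProductSpace.euclideanHausdorffMeasure_eq_volume]
  exact (hg.antilipschitz.isBounded_preimage hK).measure_lt_top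

theorem measure_face_lt_top (P : ConvexPolytope n) {v : EuclideanSpace ℝ (Fin n)}
    (hv : ‖v‖ = 1) : μHE[n - 1] (P.face v) < ⊤ :=
  euclideanHausdorffMeasure_lt_top (P.isHull.isCompact.isBounded.subset (P.face_subset v)) hv
    fun _ hx => hx.2

/-- Sums over facet normals may thus run over any larger finite set of unit vectors, in particular
one common to several polytopes. -/
theorem faceVol_eq_zero (P : ConvexPolytope n) {v : EuclideanSpace ℝ (Fin n)} (hv : ‖v‖ = 1)
    (h : v ∉ P.facetNormals) : P.faceVol v = 0 := by
  have h1 : Module.finrank ℝ (vectorSpan ℝ (P.face v)) ≤ n - 1 := by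
    rw [← finrank_orthogonal_singleton hv]
    exact Submodule.finrank_mono (vectorSpan_le_orthogonal fun x hx => hx.2)
  have hn : n ≠ 0 := by
    rintro rfl
    rw [Subsingleton.elim v 0, norm_zero] at hv
    exact zero_ne_one hv
  have h2 : Module.finrank ℝ (vectorSpan ℝ (P.face v)) + 1 ≠ n := fun h' => h ⟨hv, h'⟩
  rw [faceVol, euclideanHausdorffMeasure_eq_zero_of_convex (P.convex_face v) (by omega),
    ENNReal.toReal_zero]

theorem face_eq_convexHull {s : Finset (EuclideanSpace ℝ (Fin n))} {P : ConvexPolytope n}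
    (hP : P.carrier = convexHull ℝ (s : Set (EuclideanSpace ℝ (Fin n))))
    (v : EuclideanSpace ℝ (Fin n)) :
    P.face v = convexHull ℝ ((s : Set (EuclideanSpace ℝ (Fin n))) ∩ P.face v) := by
  classical
  refine Set.Subset.antisymm ?_ (convexHull_min Set.inter_subset_right (P.convex_face v))
  rintro x ⟨hx, hxv⟩
  have hx' := hx
  rw [hP] at hx'
  obtain ⟨w, hw0, hw1, rfl⟩ := Finset.mem_convexHull'.1 hx'
  have hsP : ∀ y ∈ s, y ∈ P.carrier := fun y hy => hP ▸ subset_convexHull ℝ _ hy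
  have hsum : ∑ y ∈ s, w y * (P.supp v - inner ℝ y v) = 0 := by
    simp only [mul_sub, Finset.sum_sub_distrib, ← Finset.sum_mul, hw1]
    rw [← hxv, sum_inner]
    simp [inner_smul_left]
  have hz := (Finset.sum_eq_zero_iff_of_nonneg fun y hy =>
    mul_nonneg (hw0 y hy) (sub_nonneg.2 (P.inner_le_supp v (hsP y hy)))).1 hsum
  have hzero : ∀ y ∈ s, y ∉ P.face v → w y = 0 := by
    intro y hy hyf
    rcases mul_eq_zero.1 (hz y hy) with h | h
    · exact h
    · exact absurd ⟨hsP y hy, by linarith⟩ hyf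
  rw [← Finset.sum_filter_of_ne (p := fun y => y ∈ P.face v)]
  · refine (convex_convexHull ℝ _).sum_mem (fun y hy => hw0 y (Finset.mem_of_mem_filter y hy)) ?_
      fun y hy => subset_convexHull ℝ _ ?_
    · rw [Finset.sum_filter_of_ne, hw1]
      intro y hy hne
      by_contra h
      exact hne (hzero y hy h)
    · rw [Finset.mem_filter] at hy
      exact hy
  · intro y hy hne
    by_contra h
    exact hne (by rw [hzero y hy h, zero_smul])

theorem finite_unit_orthogonal (L : Submodule ℝ (EuclideanSpace ℝ (Fin n)))
    (hL : Module.finrank ℝ L + 1 = n) : {v | ‖v‖ = 1 ∧ v ∈ Lᗮ}.Finite := by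
  rcases Set.eq_empty_or_nonempty {v | ‖v‖ = 1 ∧ v ∈ Lᗮ} with h | ⟨a, ha, haL⟩
  · rw [h]; exact Set.finite_empty
  have h1 : Module.finrank ℝ Lᗮ = 1 := by
    have := L.finrank_add_finrank_orthogonal
    rw [finrank_euclideanSpace_fin] at this
    omega
  refine (Set.toFinite {a, -a}).subset fun v hv => ?_
  by_contra hne
  simp only [Set.mem_insert_iff, Set.mem_singleton_iff, not_or] at hne
  have hli := linearIndependent_pair_of_norm_eq_one ha hv.1 hne.1 hne.2
  have hspan : Submodule.span ℝ (Set.range ![a, v]) ≤ Lᗮ := by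
    rw [Submodule.span_le]
    rintro _ ⟨i, rfl⟩
    fin_cases i
    · exact haL
    · exact hv.2
  have := Submodule.finrank_mono hspan
  rw [finrank_span_eq_card hli, h1, Fintype.card_fin] at this
  omega

/-- A facet is spanned by the generators lying on it, and at most two unit vectors are orthogonal to
its direction; there are finitely many sets of generators. -/
theorem finite_facetNormals (P : ConvexPolytope n) : P.facetNormals.Finite := by
  classical
  obtain ⟨s, -, hP⟩ := P.exists_finset'
  have hfin : (⋃ t ∈ {t : Finset (EuclideanSpace ℝ (Fin n)) | t ∈ s.powerset ∧
      Module.finrank ℝ (vectorSpan ℝ (t : Set (EuclideanSpace ℝ (Fin n)))) + 1 = n},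
      {v | ‖v‖ = 1 ∧ v ∈ (vectorSpan ℝ (t : Set (EuclideanSpace ℝ (Fin n))))ᗮ}).Finite :=
    (s.powerset.finite_toSet.subset fun t ht => ht.1).biUnion
      fun t ht => finite_unit_orthogonal _ ht.2
  refine hfin.subset fun v hv => ?_
  let t := s.filter (· ∈ P.face v)
  have ht : vectorSpan ℝ (t : Set (EuclideanSpace ℝ (Fin n))) = vectorSpan ℝ (P.face v) := by
    rw [face_eq_convexHull hP v, ← direction_affineSpan, ← direction_affineSpan,
      affineSpan_convexHull]
    congr 2
    ext; simp [t]
  refine Set.mem_biUnion (x := t) ⟨by simp [t], ht ▸ hv.2⟩ ⟨hv.1, ?_⟩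
  rw [ht]
  intro y hy
  have := vectorSpan_le_orthogonal (fun x hx => hx.2) hy
  rwa [Submodule.mem_orthogonal_singleton_iff_inner_left] at this

end ConvexPolytope

/-! ### `deltaPlus` is additive under cuts and simple -/

/-- The contribution to `deltaPlus` of a unit of facet volume at height `h`, where `s` is the
inner product of the facet normal with the argument. -/
noncomputable def facetWeight (p h s : ℝ) : ℝ :=
  if 0 < h then |h| ^ (1 - p) * max s 0 ^ p
  else if h < 0 then -(|h| ^ (1 - p) * max (-s) 0 ^ p) else 0

/-- Two polytopes on opposite sides of a common facet see it with data `(h, s)` and `(-h, -s)`, so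
by this oddness its contributions cancel. The minus sign and the swapped sign part for `h < 0` in
`Δ_p^±` are there for this reason. -/
theorem facetWeight_neg (p h s : ℝ) : facetWeight p (-h) (-s) = -facetWeight p h s := by
  unfold facetWeight
  rcases lt_trichotomy h 0 with h0 | rfl | h0
  · simp [h0, h0.not_gt]
  · simp
  · simp [h0, h0.not_gt]

theorem deltaMinus_eq {n : ℕ} (p : ℝ) (P : ConvexPolytope n) (u : EuclideanSpace ℝ (Fin n)) :
    deltaMinus p P u = deltaPlus p P (-u) := by
  simp [deltaMinus, deltaPlus, hPiMinusGt, hPiPlusGt, hPiMinusLt, hPiPlusLt]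

namespace ConvexPolytope

open MeasureTheory

variable {n : ℕ}

/-- The contribution of the direction `v` to `deltaPlus p P u`. -/
noncomputable def facetTerm (p : ℝ) (P : ConvexPolytope n) (u v : EuclideanSpace ℝ (Fin n)) : ℝ :=
  P.faceVol v * facetWeight p (P.supp v) (inner ℝ v u)

theorem deltaPlus_eq_sum (p : ℝ) (P : ConvexPolytope n) (u : EuclideanSpace ℝ (Fin n))
    (F : Finset (EuclideanSpace ℝ (Fin n))) (hF : ∀ v ∈ F, ‖v‖ = 1)
    (hPF : P.facetNormals ⊆ F) : deltaPlus p P u = ∑ v ∈ F, P.facetTerm p u v := by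
  classical
  have key : ∀ (q : ℝ → Prop) (g : EuclideanSpace ℝ (Fin n) → ℝ),
      ∑ᶠ v ∈ {v | v ∈ P.facetNormals ∧ q (P.supp v)}, P.faceVol v * |P.supp v| ^ (1 - p) * g v =
        ∑ v ∈ F, if q (P.supp v) then P.faceVol v * |P.supp v| ^ (1 - p) * g v else 0 := by
    intro q g
    rw [← Finset.sum_filter]
    refine finsum_mem_eq_sum_of_inter_support_eq _ ?_
    ext v
    simp only [Set.mem_inter_iff, Set.mem_ofPred_eq, Function.mem_support, Finset.coe_filter]
    constructor
    · rintro ⟨⟨h1, h2⟩, h3⟩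
      exact ⟨⟨hPF h1, h2⟩, h3⟩
    · rintro ⟨⟨h1, h2⟩, h3⟩
      refine ⟨⟨?_, h2⟩, h3⟩
      by_contra h
      exact h3 (by rw [P.faceVol_eq_zero (hF v h1) h, zero_mul, zero_mul])
  rw [deltaPlus, hPiPlusGt, hPiMinusLt, key (fun h => 0 < h) fun v => max (inner ℝ v u) 0 ^ p,
    key (fun h => h < 0) fun v => max (-inner ℝ v u) 0 ^ p, ← Finset.sum_sub_distrib]
  refine Finset.sum_congr rfl fun v _ => ?_
  rw [facetTerm, facetWeight]
  split_ifs with h1 h2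
  · linarith
  · ring
  · ring
  · ring

theorem ne_neg_of_norm_eq_one {w : EuclideanSpace ℝ (Fin n)} (hw : ‖w‖ = 1) : w ≠ -w := by
  intro h
  have h2 : (2 : ℝ) • w = 0 := by
    rw [two_smul]
    nth_rewrite 2 [h]
    exact add_neg_cancel w
  rw [(smul_eq_zero.1 h2).resolve_left two_ne_zero, norm_zero] at hw
  exact zero_ne_one hw

theorem supp_and_face_of_inner_eq {P : ConvexPolytope n} {w : EuclideanSpace ℝ (Fin n)} {c : ℝ}
    (h : ∀ x ∈ P.carrier, inner ℝ x w = c) : P.supp w = c ∧ P.face w = P.carrier := by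
  obtain ⟨x, hx⟩ := P.nonempty
  have hs : P.supp w = c := by
    rw [supp_eq_of_mem hx (fun y hy => by rw [h x hx, h y hy]), h x hx]
  refine ⟨hs, Set.Subset.antisymm (P.face_subset w) fun y hy => ⟨hy, by rw [hs, h y hy]⟩⟩

/-- Any unit normal other than `±w` gives a face of dimension at most `n - 2`, and the terms at `w`
and `-w` are both carried by the whole of `P` and cancel. -/
theorem deltaPlus_eq_zero_of_flat (p : ℝ) (P : ConvexPolytope n) (u : EuclideanSpace ℝ (Fin n))
    {w : EuclideanSpace ℝ (Fin n)} (hw : ‖w‖ = 1) {c : ℝ}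
    (h : ∀ x ∈ P.carrier, inner ℝ x w = c) : deltaPlus p P u = 0 := by
  classical
  have hw0 : w ≠ -w := ne_neg_of_norm_eq_one hw
  rw [deltaPlus_eq_sum p P u {w, -w}, Finset.sum_pair hw0]
  · have h' : ∀ x ∈ P.carrier, inner ℝ x (-w) = -c := fun x hx => by rw [inner_neg_right, h x hx]
    rw [facetTerm, facetTerm, faceVol, faceVol, (supp_and_face_of_inner_eq h).1,
      (supp_and_face_of_inner_eq h).2, (supp_and_face_of_inner_eq h').1,
      (supp_and_face_of_inner_eq h').2,
      inner_neg_left, facetWeight_neg]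
    ring
  · intro v hv
    simp only [Finset.mem_insert, Finset.mem_singleton] at hv
    rcases hv with rfl | rfl
    · exact hw
    · rwa [norm_neg]
  · intro v hv
    by_contra hne
    simp only [Finset.coe_insert, Finset.coe_singleton, Set.mem_insert_iff,
      Set.mem_singleton_iff, not_or] at hne
    have h1 := finrank_vectorSpan_add_two_le (K := P.face v) hw hv.1 hne.1 hne.2
      (fun x hx => h x hx.1) fun x hx => hx.2
    have h2 := hv.2
    omega

/-- The part of a facet lying in a piece cut off by a hyperplane transversal to it. -/
theorem facetTerm_of_cut (p : ℝ) {P P' : ConvexPolytope n} (u : EuclideanSpace ℝ (Fin n))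
    {w v : EuclideanSpace ℝ (Fin n)} (hw : ‖w‖ = 1) (hv : ‖v‖ = 1) (h1 : v ≠ w) (h2 : v ≠ -w)
    {c : ℝ} (hP' : P'.carrier = P.carrier ∩ {x | inner ℝ x w ≤ c}) :
    P'.facetTerm p u v = (μHE[n - 1] (P.face v ∩ {x | inner ℝ x w ≤ c})).toReal *
      facetWeight p (P.supp v) (inner ℝ v u) := by
  have hsub : P'.carrier ⊆ P.carrier := hP' ▸ Set.inter_subset_left
  obtain ⟨x', hx', hxv'⟩ := P'.face_nonempty v
  have hle : P'.supp v ≤ P.supp v := hxv' ▸ P.inner_le_supp v (hsub hx')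
  rcases hle.eq_or_lt with heq | hlt
  · have : P'.face v = P.face v ∩ {x | inner ℝ x w ≤ c} := by
      rw [face_eq_inter, face_eq_inter, hP', heq, Set.inter_right_comm]
    rw [facetTerm, faceVol, heq, this]
  · have hempty : P.face v ∩ {x | inner ℝ x w ≤ c} = ∅ := by
      refine Set.eq_empty_of_forall_notMem fun x hx => ?_
      have := P'.inner_le_supp v (hP' ▸ ⟨hx.1.1, hx.2⟩ : x ∈ P'.carrier)
      rw [hx.1.2] at this
      linarith
    -- The support number has dropped, so the new face lies in the cutting hyperplane: from a point
    -- strictly inside the halfspace one could move a little towards `P.face v`, stay in `P'` and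
    -- increase the inner product with `v`.
    have hface : P'.face v ⊆ {x | inner ℝ x w = c ∧ inner ℝ x v = P'.supp v} := by
      rintro x ⟨hx, hxv⟩
      refine ⟨?_, hxv⟩
      have hxc : inner ℝ x w ≤ c := (hP' ▸ hx : x ∈ P.carrier ∩ {x | inner ℝ x w ≤ c}).2
      by_contra hne
      have hxc' : inner ℝ x w < c := lt_of_le_of_ne hxc hne
      obtain ⟨y, hy, hyv⟩ := P.face_nonempty v
      obtain ⟨ε, hε0, hε1, hε⟩ : ∃ ε : ℝ, 0 < ε ∧ ε < 1 ∧
          (1 - ε) * inner ℝ x w + ε * inner ℝ y w ≤ c := by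
        have hcont : Filter.Tendsto (fun ε : ℝ => (1 - ε) * inner ℝ x w + ε * inner ℝ y w)
            (nhdsWithin 0 (Set.Ioi 0)) (nhds ((1 - 0) * inner ℝ x w + 0 * inner ℝ y w)) :=
          (Continuous.tendsto (by fun_prop) 0).mono_left nhdsWithin_le_nhds
        have ev := hcont.eventually_lt_const (u := c) (by simpa using hxc')
        obtain ⟨ε, h, hI⟩ := (ev.and (Ioo_mem_nhdsGT (zero_lt_one' ℝ))).exists
        exact ⟨ε, hI.1, hI.2, h.le⟩
      have hz : (1 - ε) • x + ε • y ∈ P'.carrier := by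
        rw [hP']
        refine ⟨P.isHull.convex (hsub hx) hy (by linarith) hε0.le (by ring), ?_⟩
        simpa [inner_add_left, inner_smul_left] using hε
      have := P'.inner_le_supp v hz
      rw [inner_add_left, inner_smul_left, inner_smul_left, hxv, hyv, conj_trivial,
        conj_trivial] at this
      nlinarith
    rw [hempty, measure_empty, ENNReal.toReal_zero, zero_mul, facetTerm, faceVol,
      measure_mono_null hface (euclideanHausdorffMeasure_inter_eq_zero hw hv h1 h2 _ _),
      ENNReal.toReal_zero, zero_mul]

theorem facetTerm_cut (p : ℝ) {P P₁ P₂ : ConvexPolytope n} (u : EuclideanSpace ℝ (Fin n))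
    {w v : EuclideanSpace ℝ (Fin n)} (hw : ‖w‖ = 1) (hv : ‖v‖ = 1) (h1 : v ≠ w) (h2 : v ≠ -w)
    {c : ℝ} (hP₁ : P₁.carrier = P.carrier ∩ {x | inner ℝ x w ≤ c})
    (hP₂ : P₂.carrier = P.carrier ∩ {x | c ≤ inner ℝ x w}) :
    P.facetTerm p u v = P₁.facetTerm p u v + P₂.facetTerm p u v := by
  have hP₂' : P₂.carrier = P.carrier ∩ {x | inner ℝ x (-w) ≤ -c} := by
    simpa [inner_neg_right] using hP₂
  rw [facetTerm_of_cut p u hw hv h1 h2 hP₁, facetTerm_of_cut p u (w := -w) (by rwa [norm_neg]) hv h2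
    (by rwa [neg_neg]) hP₂', ← add_mul, ← ENNReal.toReal_add, facetTerm, faceVol]
  · congr 2
    have hnull : μHE[n - 1] ((P.face v ∩ {x | inner ℝ x w ≤ c}) ∩
        (P.face v ∩ {x | inner ℝ x (-w) ≤ -c})) = 0 := by
      refine measure_mono_null ?_ (euclideanHausdorffMeasure_inter_eq_zero hw hv h1 h2 c (P.supp v))
      rintro x ⟨hx1, hx2⟩
      have := hx2.2
      rw [Set.mem_ofPred_eq, inner_neg_right, neg_le_neg_iff] at this
      exact ⟨le_antisymm hx1.2 this, hx1.1.2⟩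
    have hmeas : MeasurableSet (P.face v ∩ {x | inner ℝ x (-w) ≤ -c}) :=
      ((P.isClosed_face v).inter
        (isClosed_le (by fun_prop) (by fun_prop))).measurableSet
    rw [← measure_union₀ hmeas.nullMeasurableSet hnull, ← Set.inter_union_distrib_left]
    congr 1
    refine (Set.inter_eq_left.2 fun x _ => ?_).symm
    simp only [Set.mem_union, Set.mem_ofPred_eq, inner_neg_right, neg_le_neg_iff]
    exact le_total _ _
  · exact (measure_mono Set.inter_subset_left).trans_lt (P.measure_face_lt_top hv) |>.ne
  · exact (measure_mono Set.inter_subset_left).trans_lt (P.measure_face_lt_top hv) |>.ne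

theorem exists_inner_eq {P : ConvexPolytope n} {w : EuclideanSpace ℝ (Fin n)} {c : ℝ}
    (hlo : ∃ x ∈ P.carrier, inner ℝ x w ≤ c) (hhi : ∃ x ∈ P.carrier, c ≤ inner ℝ x w) :
    ∃ x ∈ P.carrier, inner ℝ x w = c := by
  obtain ⟨x, hx, hxc⟩ := hlo
  obtain ⟨y, hy, hyc⟩ := hhi
  exact P.isHull.convex.isPreconnected.intermediate_value hx hy
    (f := fun x => (inner ℝ x w : ℝ)) (by fun_prop) ⟨hxc, hyc⟩

theorem face_of_cut {P P' : ConvexPolytope n} {w : EuclideanSpace ℝ (Fin n)} {c : ℝ}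
    (hP' : P'.carrier = P.carrier ∩ {x | inner ℝ x w ≤ c})
    (hex : ∃ x ∈ P.carrier, inner ℝ x w = c) :
    P'.supp w = c ∧ P'.face w = P.carrier ∩ {x | inner ℝ x w = c} := by
  obtain ⟨x, hx, hxc⟩ := hex
  have hx' : x ∈ P'.carrier := hP' ▸ ⟨hx, hxc.le⟩
  have hs : P'.supp w = c := by
    rw [supp_eq_of_mem hx', hxc]
    intro y hy
    rw [hP'] at hy
    rw [hxc]
    exact hy.2
  refine ⟨hs, ?_⟩
  rw [face_eq_inter, hP', hs, Set.inter_assoc]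
  congr 1
  ext y
  simp only [Set.mem_inter_iff, Set.mem_ofPred_eq, and_iff_right_iff_imp]
  exact fun h => h.le

theorem facetTerm_of_cut_of_lt (p : ℝ) {P P' : ConvexPolytope n} (u : EuclideanSpace ℝ (Fin n))
    {w : EuclideanSpace ℝ (Fin n)} {c : ℝ} (hP' : P'.carrier = P.carrier ∩ {x | c ≤ inner ℝ x w})
    (hex : ∃ x ∈ P.carrier, c ≤ inner ℝ x w) : P'.facetTerm p u w = P.facetTerm p u w := by
  obtain ⟨x, hx, hxc⟩ := hex
  obtain ⟨y, hy, hyw⟩ := P.face_nonempty w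
  have hyc : c ≤ inner ℝ y w := by rw [hyw]; exact hxc.trans (P.inner_le_supp w hx)
  have hs : P'.supp w = P.supp w := by
    rw [supp_eq_of_mem (hP' ▸ ⟨hy, hyc⟩ : y ∈ P'.carrier), hyw]
    intro z hz
    rw [hyw]
    rw [hP'] at hz
    exact P.inner_le_supp w hz.1
  have hf : P'.face w = P.face w := by
    rw [face_eq_inter, face_eq_inter, hP', hs, Set.inter_assoc]
    congr 1
    ext z
    simp only [Set.mem_inter_iff, Set.mem_ofPred_eq, and_iff_right_iff_imp]
    intro h
    rw [h, ← hyw]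
    exact hyc
  rw [facetTerm, facetTerm, faceVol, faceVol, hs, hf]

/-- In directions other than `±w` each facet is divided between the two pieces. In the directions
`±w` each piece inherits one outer facet of `P`, and the two copies of the section cancel. -/
theorem deltaPlus_cut (p : ℝ) {P P₁ P₂ : ConvexPolytope n} (u : EuclideanSpace ℝ (Fin n))
    {w : EuclideanSpace ℝ (Fin n)} (hw : ‖w‖ = 1) {c : ℝ}
    (hP₁ : P₁.carrier = P.carrier ∩ {x | inner ℝ x w ≤ c})
    (hP₂ : P₂.carrier = P.carrier ∩ {x | c ≤ inner ℝ x w}) :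
    deltaPlus p P u = deltaPlus p P₁ u + deltaPlus p P₂ u := by
  classical
  have hw' : ‖-w‖ = 1 := by rwa [norm_neg]
  have hP₁' : P₁.carrier = P.carrier ∩ {x | -c ≤ inner ℝ x (-w)} := by
    simpa [inner_neg_right] using hP₁
  have hP₂' : P₂.carrier = P.carrier ∩ {x | inner ℝ x (-w) ≤ -c} := by
    simpa [inner_neg_right] using hP₂
  obtain ⟨x₁, hx₁⟩ := P₁.nonempty
  obtain ⟨x₂, hx₂⟩ := P₂.nonempty
  rw [hP₁] at hx₁
  rw [hP₂] at hx₂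
  have hex := exists_inner_eq (w := w) ⟨x₁, hx₁⟩ ⟨x₂, hx₂⟩
  have hex' : ∃ x ∈ P.carrier, inner ℝ x (-w) = -c := by simpa [inner_neg_right] using hex
  have hw0 : w ≠ -w := ne_neg_of_norm_eq_one hw
  let N : Finset (EuclideanSpace ℝ (Fin n)) := P.finite_facetNormals.toFinset ∪
    P₁.finite_facetNormals.toFinset ∪ P₂.finite_facetNormals.toFinset
  let F : Finset (EuclideanSpace ℝ (Fin n)) := insert w (insert (-w) ((N.erase w).erase (-w)))
  have hF : ∀ v ∈ F, ‖v‖ = 1 := by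
    intro v hv
    simp only [F, N, Finset.mem_insert, Finset.mem_erase, Finset.mem_union,
      Set.Finite.mem_toFinset] at hv
    rcases hv with rfl | rfl | ⟨-, -, (h | h) | h⟩
    · exact hw
    · exact hw'
    all_goals exact h.1
  have hsub : ∀ v ∈ N, v ∈ F := by
    intro v hv
    simp only [F, Finset.mem_insert, Finset.mem_erase]
    tauto
  have hPF : P.facetNormals ⊆ F := fun v hv => hsub v (by simp [N, hv])
  have hPF₁ : P₁.facetNormals ⊆ F := fun v hv => hsub v (by simp [N, hv])
  have hPF₂ : P₂.facetNormals ⊆ F := fun v hv => hsub v (by simp [N, hv])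
  have hsum : ∀ g : EuclideanSpace ℝ (Fin n) → ℝ,
      ∑ v ∈ F, g v = g w + (g (-w) + ∑ v ∈ (N.erase w).erase (-w), g v) := by
    intro g
    rw [Finset.sum_insert (by simp [hw0]), Finset.sum_insert (by simp)]
  have hrest : ∑ v ∈ (N.erase w).erase (-w), P.facetTerm p u v =
      ∑ v ∈ (N.erase w).erase (-w), P₁.facetTerm p u v +
      ∑ v ∈ (N.erase w).erase (-w), P₂.facetTerm p u v := by
    rw [← Finset.sum_add_distrib]
    refine Finset.sum_congr rfl fun v hv => ?_
    have hvF : v ∈ F := by simp only [F, Finset.mem_insert]; exact Or.inr (Or.inr hv)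
    simp only [Finset.mem_erase] at hv
    exact facetTerm_cut p u hw (hF v hvF) hv.2.1 hv.1 hP₁ hP₂
  obtain ⟨s₁, f₁⟩ := face_of_cut hP₁ hex
  obtain ⟨s₂, f₂⟩ := face_of_cut hP₂' hex'
  have hcancel : P₁.facetTerm p u w + P₂.facetTerm p u (-w) = 0 := by
    rw [facetTerm, facetTerm, faceVol, faceVol, s₁, s₂, f₁, f₂, inner_neg_left, facetWeight_neg]
    simp only [inner_neg_right, neg_inj]
    ring
  have hup := facetTerm_of_cut_of_lt p u hP₂ ⟨x₂, hx₂⟩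
  have hdown := facetTerm_of_cut_of_lt p u hP₁' (by
    simpa [inner_neg_right] using (⟨x₁, hx₁⟩ : ∃ x ∈ P.carrier, inner ℝ x w ≤ c))
  rw [deltaPlus_eq_sum p P u F hF hPF, deltaPlus_eq_sum p P₁ u F hF hPF₁,
    deltaPlus_eq_sum p P₂ u F hF hPF₂, hsum, hsum, hsum, hrest, ← hup, ← hdown]
  linarith

end ConvexPolytope

/-! ### `deltaPlus` of a simplex with a vertex at the origin -/

/-- The determinant of a family of vectors. -/
noncomputable def vecDet {n : ℕ} (x : Fin n → EuclideanSpace ℝ (Fin n)) : ℝ :=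
  (Matrix.of fun i j => x i j).det

section Det

variable {n : ℕ}

theorem vecDet_ne_zero_iff {x : Fin n → EuclideanSpace ℝ (Fin n)} :
    vecDet x ≠ 0 ↔ LinearIndependent ℝ x := by
  rw [vecDet, ← isUnit_iff_ne_zero, ← Matrix.isUnit_iff_isUnit_det,
    ← Matrix.linearIndependent_rows_iff_isUnit,
    ← (WithLp.linearEquiv 2 ℝ (Fin n → ℝ)).toLinearMap.linearIndependent_iff
      (LinearEquiv.ker _)]
  rfl

theorem exists_inner_eq_of_linearIndependent {E ι : Type*} [NormedAddCommGroup E]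
    [InnerProductSpace ℝ E] [FiniteDimensional ℝ E] [Fintype ι] [Nonempty ι] {x : ι → E} (hx : LinearIndependent ℝ x)
    (hcard : Fintype.card ι = Module.finrank ℝ E) (a : ι → ℝ) :
    ∃ w : E, ∀ i, inner ℝ (x i) w = a i := by
  let b := basisOfLinearIndependentOfCardEqFinrank hx hcard
  let f : E →ₗ[ℝ] ℝ := b.constr ℝ a
  refine ⟨(InnerProductSpace.toDual ℝ E).symm f.toContinuousLinearMap, fun i => ?_⟩
  have hb : x i = b i := by simp [b]
  rw [real_inner_comm, InnerProductSpace.toDual_symm_apply, hb]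
  exact b.constr_basis ℝ a i

theorem inner_eq_dotProduct (x y : EuclideanSpace ℝ (Fin n)) :
    inner ℝ x y = (x : Fin n → ℝ) ⬝ᵥ (y : Fin n → ℝ) := by
  simp [PiLp.inner_apply, dotProduct, mul_comm]

/-- The volume of a parallelepiped is its height times the volume of its base. -/
theorem sq_vecDet_eq {m : ℕ} {x : Fin (m + 1) → EuclideanSpace ℝ (Fin (m + 1))}
    (hx : LinearIndependent ℝ x) {v : EuclideanSpace ℝ (Fin (m + 1))} (hv : ‖v‖ = 1) {h : ℝ}
    (hxv : ∀ i, inner ℝ (x i) v = h) :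
    vecDet x ^ 2 = h ^ 2 * (Matrix.gram ℝ fun i : Fin m => x i.succ - x 0).det := by
  let d : Fin (m + 1) → EuclideanSpace ℝ (Fin (m + 1)) :=
    Fin.cons (x 0) fun i => x i.succ - x 0
  let D : Matrix (Fin (m + 1)) (Fin (m + 1)) ℝ := Matrix.of fun i j => d i j
  have hD : vecDet x = D.det := by
    refine (Matrix.det_eq_of_forall_row_eq_smul_add_const (fun i => if i = 0 then 0 else 1) 0
      (by simp) fun i j => ?_)
    refine Fin.cases ?_ (fun i => ?_) i
    · simp [D, d]
    · simp [D, d]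
  have hD0 : IsUnit D.det := by
    rw [← hD, isUnit_iff_ne_zero]
    exact vecDet_ne_zero_iff.2 hx
  -- Coordinates of `v` in the rows of `D`. All rows but the first are orthogonal to `v`, so pairing
  -- with `v` gives `a 0 * h = 1`.
  let a : Fin (m + 1) → ℝ := Matrix.vecMul (v : Fin (m + 1) → ℝ) D⁻¹
  have ha : ∑ k, a k • D k = (v : Fin (m + 1) → ℝ) := by
    rw [← Matrix.vecMul_eq_sum, Matrix.vecMul_vecMul, Matrix.nonsing_inv_mul _ hD0,
      Matrix.vecMul_one]
  have hdv : ∀ i : Fin m, (D i.succ) ⬝ᵥ (v : Fin (m + 1) → ℝ) = 0 := by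
    intro i
    have : inner ℝ (d i.succ) v = 0 := by simp [d, inner_sub_left, hxv]
    rwa [inner_eq_dotProduct] at this
  have hd0 : (D 0) ⬝ᵥ (v : Fin (m + 1) → ℝ) = h := by
    have : inner ℝ (d 0) v = h := by simp [d, hxv]
    rwa [inner_eq_dotProduct] at this
  have hvv : (v : Fin (m + 1) → ℝ) ⬝ᵥ (v : Fin (m + 1) → ℝ) = 1 := by
    rw [← inner_eq_dotProduct, real_inner_self_eq_norm_sq, hv, one_pow]
  have ha0 : a 0 * h = 1 := by
    have h1 := hvv
    conv_lhs at h1 => rw [← ha]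
    rw [sum_dotProduct, Fin.sum_univ_succ] at h1
    simpa [ha, smul_dotProduct, hd0, hdv] using h1
  -- Replacing the first row by `v` multiplies the determinant by `a 0 = 1 / h`, and makes `A *
  -- A.transpose` block diagonal with blocks `1` and the Gram matrix.
  let A := D.updateRow 0 (v : Fin (m + 1) → ℝ)
  have hA : A.det = a 0 * D.det := by
    rw [← smul_eq_mul, ← Matrix.det_updateRow_sum D 0 a, ha]
  have hG : A.det ^ 2 = (Matrix.gram ℝ fun i : Fin m => x i.succ - x 0).det := by
    have h1 : A.det ^ 2 = (A * A.transpose).det := by rw [Matrix.det_mul, Matrix.det_transpose, sq]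
    have e0 : A 0 = (v : Fin (m + 1) → ℝ) := by simp [A]
    have es : ∀ i : Fin m, A i.succ = D i.succ := fun i => by simp [A]
    have hent : ∀ i j, (A * A.transpose) i j = A i ⬝ᵥ A j := fun i j => rfl
    rw [h1, Matrix.det_succ_column_zero, Fin.sum_univ_succ, Finset.sum_eq_zero]
    · rw [hent, e0, hvv]
      simp only [Fin.val_zero, pow_zero, one_mul, add_zero, Fin.succAbove_zero]
      congr 1
      ext i j
      rw [Matrix.submatrix_apply, hent, es, es, Matrix.gram_apply, inner_eq_dotProduct]
      rfl
    · intro i _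
      rw [hent, e0, es, hdv]
      simp
  rw [← hG, hA, hD]
  linear_combination (-(D.det ^ 2) * (a 0 * h + 1)) * ha0

end Det

/-! ### Volume of the facet opposite the origin. -/

section SimplexVolume

open MeasureTheory

/-- The standard corner simplex. -/
abbrev unitCorner (m : ℕ) : Set (EuclideanSpace ℝ (Fin m)) :=
  cornerSimplex fun i => EuclideanSpace.single i (1 : ℝ)

theorem volume_unitCorner_pos (m : ℕ) : 0 < (volume (unitCorner m)).toReal := by
  refine ENNReal.toReal_pos ?_ ((isHull_cornerSimplex _).isCompact.isBounded.measure_lt_top).ne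
  let U : Set (EuclideanSpace ℝ (Fin m)) := {t | ∀ i, 0 < t i} ∩ {t | ∑ i, t i < 1}
  have hU : IsOpen U := by
    refine IsOpen.inter ?_ (isOpen_lt (by fun_prop) (by fun_prop))
    rw [Set.ofPred_forall]
    exact isOpen_iInter_of_finite fun i => isOpen_lt (by fun_prop) (by fun_prop)
  have hne : U.Nonempty := by
    refine ⟨WithLp.toLp 2 fun _ => 1 / (m + 1 : ℝ), fun i => ?_, ?_⟩
    · change 0 < 1 / (m + 1 : ℝ)
      positivity
    · simp only [Set.mem_ofPred_eq, Finset.sum_const, Finset.card_univ, Fintype.card_fin,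
        nsmul_eq_mul]
      rw [mul_one_div, div_lt_one (by positivity)]
      linarith
  have hsub : U ⊆ unitCorner m := by
    rintro t ⟨h0, h1⟩
    refine mem_cornerSimplex.2 ⟨fun i => t i, fun i => (h0 i).le, le_of_lt h1, ?_⟩
    ext j
    simp [Pi.single_apply]
  exact ((hU.measure_pos volume hne).trans_le (measure_mono hsub)).ne'

/-- The facet is a translate of a linear image of the standard corner simplex. The volume factor of
the linear map is the root of the Gram determinant, which `sq_vecDet_eq` relates to `vecDet x`. -/
theorem measure_convexHull_range {m : ℕ} {x : Fin (m + 1) → EuclideanSpace ℝ (Fin (m + 1))}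
    (hx : LinearIndependent ℝ x) {v : EuclideanSpace ℝ (Fin (m + 1))} (hv : ‖v‖ = 1) {h : ℝ}
    (hpos : 0 < h) (hxv : ∀ i, inner ℝ (x i) v = h) :
    (μHE[m] (convexHull ℝ (Set.range x))).toReal * h =
      (volume (unitCorner m)).toReal * |vecDet x| := by
  let L : EuclideanSpace ℝ (Fin m) →ₗ[ℝ] EuclideanSpace ℝ (Fin (m + 1)) :=
    (EuclideanSpace.basisFun (Fin m) ℝ).toBasis.constr ℝ fun i => x i.succ - x 0
  have hL : ∀ i, L (EuclideanSpace.single i 1) = x i.succ - x 0 := by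
    intro i
    have := (EuclideanSpace.basisFun (Fin m) ℝ).toBasis.constr_basis ℝ
      (fun i => x i.succ - x 0) i
    rwa [OrthonormalBasis.coe_toBasis, EuclideanSpace.basisFun_apply] at this
  have hrange : Set.range x =
      (fun y => x 0 + y) '' insert 0 (Set.range fun i : Fin m => x i.succ - x 0) := by
    rw [Set.image_insert_eq, ← Set.range_comp, add_zero]
    ext y
    simp only [Set.mem_range, Set.mem_insert_iff, Function.comp_apply, add_sub_cancel]
    rw [Fin.exists_fin_succ, eq_comm]
  have himg : convexHull ℝ (Set.range x) = (fun y => x 0 + y) '' (L '' unitCorner m) := by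
    rw [hrange, image_cornerSimplex, cornerSimplex]
    have : (L ∘ fun i => EuclideanSpace.single i (1 : ℝ)) = fun i : Fin m => x i.succ - x 0 :=
      funext hL
    rw [this]
    have := AffineMap.image_convexHull
      (AffineEquiv.constVAdd ℝ (EuclideanSpace ℝ (Fin (m + 1))) (x 0)).toAffineMap
      (insert 0 (Set.range fun i : Fin m => x i.succ - x 0))
    exact this.symm
  have hnd : L.normDet ^ 2 * h ^ 2 = vecDet x ^ 2 := by
    have h1 := L.normDet_sq_eq_det_gram (EuclideanSpace.basisFun (Fin m) ℝ)
    simp only [EuclideanSpace.basisFun_apply, hL] at h1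
    rw [sq_vecDet_eq hx hv hxv, ← h1, mul_comm]
    rfl
  have hnd' : L.normDet * h = |vecDet x| := by
    rw [← abs_of_nonneg (mul_nonneg L.normDet_nonneg hpos.le), ← sq_eq_sq_iff_abs_eq_abs, mul_pow,
      hnd]
  have hvol := L.euclideanHausdorffMeasure_image_eq_normDet_mul_volume (unitCorner m)
  rw [finrank_euclideanSpace_fin] at hvol
  rw [himg, (isometry_add_left (x 0)).euclideanHausdorffMeasure_image, hvol, ENNReal.toReal_mul,
    ENNReal.toReal_ofReal L.normDet_nonneg, ← hnd']
  ring

end SimplexVolume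

namespace ConvexPolytope

theorem face_cornerSimplex {n : ℕ} {P : ConvexPolytope n}
    {x : Fin n → EuclideanSpace ℝ (Fin n)} (hP : P.carrier = cornerSimplex x) (i₀ : Fin n)
    {v : EuclideanSpace ℝ (Fin n)} {h : ℝ} (hpos : 0 < h) (hxv : ∀ i, inner ℝ (x i) v = h) :
    P.supp v = h ∧ P.face v = convexHull ℝ (Set.range x) := by
  have hinner : ∀ t : Fin n → ℝ, inner ℝ (∑ i, t i • x i) v = (∑ i, t i) * h := by
    intro t
    simp [sum_inner, inner_smul_left, hxv, Finset.sum_mul]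
  have hs : P.supp v = h := by
    rw [supp_eq_of_mem (x := x i₀) (hP ▸ mem_cornerSimplex_self x i₀), hxv]
    intro y hy
    rw [hP] at hy
    obtain ⟨t, -, ht1, rfl⟩ := mem_cornerSimplex.1 hy
    rw [hinner, hxv]
    nlinarith
  refine ⟨hs, Set.Subset.antisymm ?_ (convexHull_min ?_ (P.convex_face v))⟩
  · rintro y ⟨hy, hyv⟩
    rw [hP] at hy
    obtain ⟨t, ht0, -, rfl⟩ := mem_cornerSimplex.1 hy
    rw [hinner, hs] at hyv
    refine (convex_convexHull ℝ _).sum_mem (fun i _ => ht0 i) ?_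
      fun i _ => subset_convexHull ℝ _ ⟨i, rfl⟩
    exact mul_right_cancel₀ hpos.ne' (hyv.trans (one_mul h).symm)
  · rintro _ ⟨i, rfl⟩
    exact ⟨hP ▸ mem_cornerSimplex_self x i, by rw [hs, hxv]⟩

/-- Facets of a corner simplex other than the one opposite the origin pass through the origin. -/
theorem facetTerm_cornerSimplex_eq_zero {n : ℕ} (p : ℝ) {P : ConvexPolytope n}
    {x : Fin n → EuclideanSpace ℝ (Fin n)} (hx : LinearIndependent ℝ x)
    (hP : P.carrier = cornerSimplex x) (u : EuclideanSpace ℝ (Fin n)) [Nonempty (Fin n)]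
    {v v' : EuclideanSpace ℝ (Fin n)} {h : ℝ} (hpos : 0 < h) (hv : ‖v‖ = 1)
    (hxv : ∀ i, inner ℝ (x i) v = h) (hv' : ‖v'‖ = 1) (hne : v' ≠ v) :
    P.facetTerm p u v' = 0 := by
  have hcard : Fintype.card (Fin n) = Module.finrank ℝ (EuclideanSpace ℝ (Fin n)) := by simp
  have h0 : 0 ≤ P.supp v' := by
    have := P.inner_le_supp v' (hP ▸ zero_mem_cornerSimplex x : (0 : EuclideanSpace ℝ (Fin n)) ∈ _)
    rwa [inner_zero_left] at this
  rcases h0.eq_or_lt with h0 | h0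
  · rw [facetTerm, ← h0, facetWeight]
    simp
  have hle : ∀ i, inner ℝ (x i) v' ≤ P.supp v' := fun i =>
    P.inner_le_supp v' (hP ▸ mem_cornerSimplex_self x i)
  obtain ⟨i, hi⟩ : ∃ i, inner ℝ (x i) v' < P.supp v' := by
    by_contra! hall
    have heq : ∀ i, inner ℝ (x i) v' = P.supp v' := fun i => le_antisymm (hle i) (hall i)
    have hspan : Submodule.span ℝ (Set.range x) = ⊤ :=
      hx.span_eq_top_of_card_eq_finrank' hcard
    have hvv : v' = (P.supp v' / h) • v := by
      refine ext_inner_left ℝ fun y => ?_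
      have hy : y ∈ Submodule.span ℝ (Set.range x) := hspan ▸ Submodule.mem_top
      induction hy using Submodule.span_induction with
      | mem y hy =>
        obtain ⟨i, rfl⟩ := hy
        rw [inner_smul_right, heq, hxv, div_mul_cancel₀ _ hpos.ne']
      | zero => simp
      | add y z _ _ hy hz => rw [inner_add_left, inner_add_left, hy, hz]
      | smul a y _ hy => rw [inner_smul_left, inner_smul_left, hy]
    have hn := congrArg norm hvv
    rw [norm_smul, hv, hv', mul_one, Real.norm_of_nonneg (div_nonneg h0.le hpos.le)] at hn
    rw [← hn, one_smul] at hvv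
    exact hne hvv
  -- The face misses the vertex `x i` and has positive height, so it lies in the hyperplane where
  -- the `i`-th coordinate is `0`, with normal `g`. That hyperplane contains the origin, hence `g`
  -- is not parallel to `v'` and the face has dimension at most `n - 2`.
  obtain ⟨g, hg⟩ := exists_inner_eq_of_linearIndependent hx hcard (Pi.single i 1)
  have hg0 : g ≠ 0 := by
    rintro rfl
    have := hg i
    simp at this
  have hfg : ∀ y ∈ P.face v', inner ℝ y g = 0 := by
    rintro y ⟨hy, hyv⟩
    rw [hP] at hy
    obtain ⟨t, ht0, ht1, rfl⟩ := mem_cornerSimplex.1 hy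
    simp only [sum_inner, inner_smul_left, conj_trivial] at hyv ⊢
    have h1 : ∑ j, t j * inner ℝ (x j) v' + t i * (P.supp v' - inner ℝ (x i) v') ≤
        ∑ j, t j * P.supp v' := by
      rw [← sub_nonneg]
      have : ∑ j, t j * P.supp v' - (∑ j, t j * inner ℝ (x j) v' +
          t i * (P.supp v' - inner ℝ (x i) v')) =
          ∑ j, t j * (P.supp v' - inner ℝ (x j) v') - t i * (P.supp v' - inner ℝ (x i) v') := by
        simp only [mul_sub, Finset.sum_sub_distrib]
        ring
      rw [this, sub_nonneg]
      exact Finset.single_le_sum (f := fun j => t j * (P.supp v' - inner ℝ (x j) v'))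
        (fun j _ => mul_nonneg (ht0 j) (sub_nonneg.2 (hle j))) (Finset.mem_univ i)
    rw [← Finset.sum_mul, hyv] at h1
    have hti : t i = 0 := by
      by_contra hti
      have := (ht0 i).lt_of_ne' hti
      nlinarith
    simp [hg, Pi.single_apply, hti]
  have hgn : ‖(‖g‖⁻¹ : ℝ) • g‖ = 1 := by
    rw [norm_smul, norm_inv, norm_norm, inv_mul_cancel₀ (norm_ne_zero_iff.2 hg0)]
  have hfg' : ∀ y ∈ P.face v', inner ℝ y ((‖g‖⁻¹ : ℝ) • g) = 0 := fun y hy => by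
    rw [inner_smul_right, hfg y hy, mul_zero]
  obtain ⟨y, hy⟩ := P.face_nonempty v'
  have hn1 : (‖g‖⁻¹ : ℝ) • g ≠ v' := by
    intro h'
    have h1 := hfg' y hy
    rw [h', hy.2] at h1
    exact h0.ne' h1
  have hn2 : (‖g‖⁻¹ : ℝ) • g ≠ -v' := by
    intro h'
    have h1 := hfg' y hy
    rw [h', inner_neg_right, hy.2] at h1
    linarith
  have := finrank_vectorSpan_add_two_le hv' hgn hn1 hn2 (fun y hy => hy.2) hfg'
  rw [facetTerm, faceVol, euclideanHausdorffMeasure_eq_zero_of_convex (P.convex_face v')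
    (by omega), ENNReal.toReal_zero, zero_mul]

/-- With `h` the distance of the far facet, `⟨v, u⟩ = h ∑ yᵢ`, so the powers `h ^ (1 - p)` and `h ^
p` combine to `h`, and base times height is a multiple of the determinant. -/
theorem deltaPlus_cornerSimplex {m : ℕ} (p : ℝ) {P : ConvexPolytope (m + 1)}
    {x : Fin (m + 1) → EuclideanSpace ℝ (Fin (m + 1))} (hx : LinearIndependent ℝ x)
    (hP : P.carrier = cornerSimplex x) (y : Fin (m + 1) → ℝ) :
    deltaPlus p P (∑ i, y i • x i) =
      (MeasureTheory.volume (unitCorner m)).toReal * |vecDet x| * max (∑ i, y i) 0 ^ p := by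
  classical
  obtain ⟨w, hw⟩ := exists_inner_eq_of_linearIndependent hx (by simp) fun _ => 1
  have hw0 : w ≠ 0 := by
    rintro rfl
    have := hw 0
    simp at this
  have hwn : 0 < ‖w‖ := norm_pos_iff.2 hw0
  set h := ‖w‖⁻¹ with hh
  have hpos : 0 < h := inv_pos.2 hwn
  set v := h • w with hvdef
  have hv : ‖v‖ = 1 := by
    rw [hvdef, norm_smul, Real.norm_of_nonneg hpos.le, hh, inv_mul_cancel₀ hwn.ne']
  have hxv : ∀ i, inner ℝ (x i) v = h := fun i => by
    rw [hvdef, inner_smul_right, hw, mul_one]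
  obtain ⟨hs, hf⟩ := face_cornerSimplex hP 0 hpos hxv
  -- Inserting `v` avoids having to show that it is a facet normal.
  rw [deltaPlus_eq_sum p P _ (insert v P.finite_facetNormals.toFinset),
    Finset.sum_eq_single_of_mem v (Finset.mem_insert_self _ _)]
  · have hvu : inner ℝ v (∑ i, y i • x i) = h * ∑ i, y i := by
      rw [real_inner_comm]
      simp only [sum_inner, inner_smul_left, conj_trivial, hxv]
      rw [← Finset.sum_mul, mul_comm]
    have hvol := measure_convexHull_range hx hv hpos hxv
    have hw : h ^ (1 - p) * (h ^ p) = h := by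
      rw [← Real.rpow_add hpos, sub_add_cancel, Real.rpow_one]
    have hmax : max (h * ∑ i, y i) 0 = h * max (∑ i, y i) 0 := by
      rw [mul_max_of_nonneg _ _ hpos.le, mul_zero]
    rw [facetTerm, faceVol, hs, hf, facetWeight, if_pos hpos, abs_of_pos hpos, hvu, hmax,
      Real.mul_rpow hpos.le (le_max_right _ _), ← hvol, Nat.add_sub_cancel]
    linear_combination ((MeasureTheory.Measure.euclideanHausdorffMeasure m
      (convexHull ℝ (Set.range x))).toReal * max (∑ i, y i) 0 ^ p) * hw
  · intro v' hv' hne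
    refine facetTerm_cornerSimplex_eq_zero p hx hP _ hpos hv hxv ?_ hne
    rw [Finset.mem_insert, Set.Finite.mem_toFinset] at hv'
    rcases hv' with rfl | hv'
    · exact hv
    · exact hv'.1
  · intro v' hv'
    rw [Finset.mem_insert, Set.Finite.mem_toFinset] at hv'
    rcases hv' with rfl | hv'
    · exact hv
    · exact hv'.1
  · intro v' hv'
    simp [hv']

end ConvexPolytope

/-! ### A functional equation on simplices and Cauchy's equation -/

section FunctionalEquation

variable {ι : Type*} [DecidableEq ι]

/-- The coordinates with respect to the basis in which the `i`-th basis vector is replaced by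
`(1 - l)` times itself plus `l` times the `j`-th one. -/
noncomputable def edgeCoord (i j : ι) (l : ℝ) (y : ι → ℝ) : ι → ℝ :=
  Function.update (Function.update y i (y i / (1 - l))) j (y j - l * y i / (1 - l))

theorem edgeCoord_self {i j : ι} (hij : i ≠ j) (l : ℝ) (y : ι → ℝ) :
    edgeCoord i j l y i = y i / (1 - l) := by simp [edgeCoord, hij]

theorem edgeCoord_right (i j : ι) (l : ℝ) (y : ι → ℝ) :
    edgeCoord i j l y j = y j - l * y i / (1 - l) := by simp [edgeCoord]

theorem edgeCoord_of_ne {i j k : ι} (l : ℝ) (y : ι → ℝ) (hi : k ≠ i) (hj : k ≠ j) :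
    edgeCoord i j l y k = y k := by simp [edgeCoord, hi, hj]

theorem edgeCoord_eq_self {i j : ι} (l : ℝ) {y : ι → ℝ} (hi : y i = 0) :
    edgeCoord i j l y = y := by
  ext k
  simp only [edgeCoord, hi, zero_div, mul_zero, sub_zero, Function.update_apply]
  split_ifs with h1 h2
  · rw [h1]
  · rw [h2, hi]
  · rfl

/-- The functional equation coming from cutting simplices through an edge. -/
def EdgeEquation (G : ℝ → (ι → ℝ) → ℝ) : Prop :=
  ∀ t, 0 < t → ∀ i j : ι, i ≠ j → ∀ l, 0 < l → l < 1 → ∀ y,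
    G t y = G ((1 - l) * t) (edgeCoord i j l y) + G (l * t) (edgeCoord j i (1 - l) y)

/-- The equation is read backwards: at `c eᵢ` with `l = b / (1 + b)`, the left side and the second
term on the right vanish by hypothesis, and the first term is the value at the mixed vector. -/
theorem EdgeEquation.opposite_signs {G : ℝ → (ι → ℝ) → ℝ} (hG : EdgeEquation G) {i j : ι}
    (hij : i ≠ j) {c : ℝ} (hbase : ∀ t, 0 < t → G t (Pi.single i c) = 0) {t : ℝ} (ht : 0 < t)
    {b : ℝ} (hb : 0 < b) : G t (Pi.single i ((1 + b) * c) + Pi.single j (-(b * c))) = 0 := by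
  have hb1 : 0 < 1 + b := by linarith
  have hl : 0 < b / (1 + b) := div_pos hb hb1
  have hl1 : b / (1 + b) < 1 := (div_lt_one hb1).2 (by linarith)
  have h := hG ((1 + b) * t) (mul_pos hb1 ht) i j hij _ hl hl1 (Pi.single i c)
  rw [edgeCoord_eq_self (i := j) _ (by simp [hij.symm]), hbase _ (mul_pos hb1 ht),
    hbase _ (mul_pos hl (mul_pos hb1 ht)), add_zero] at h
  have e1 : (1 - b / (1 + b)) * ((1 + b) * t) = t := by field_simp; ring
  have e2 : edgeCoord i j (b / (1 + b)) (Pi.single i c) =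
      Pi.single i ((1 + b) * c) + Pi.single j (-(b * c)) := by
    have hden : 1 - b / (1 + b) = (1 + b)⁻¹ := by field_simp; ring
    ext k
    rw [edgeCoord, hden]
    by_cases h1 : k = j
    · subst h1
      simp only [Pi.single_eq_same, Function.update_self, Pi.add_apply, Pi.single_eq_of_ne hij.symm]
      field_simp
      ring
    · by_cases h2 : k = i
      · subst h2
        simp only [Pi.single_eq_same, Function.update_self, Function.update_of_ne h1, Pi.add_apply,
          Pi.single_eq_of_ne h1]
        field_simp
        ring
      · simp [h1, h2]
  rw [e1, e2] at h
  exact h.symm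

variable [Fintype ι]

theorem sum_edgeCoord_smul {M : Type*} [AddCommGroup M] [Module ℝ M] {i j : ι} (hij : i ≠ j)
    {l : ℝ} (hl : l < 1) (y : ι → ℝ) (x : ι → M) :
    ∑ k, edgeCoord i j l y k • Function.update x i ((1 - l) • x i + l • x j) k =
      ∑ k, y k • x k := by
  have hl' : (1 - l) ≠ 0 := by linarith
  rw [sum_eq_add_add_sum_erase hij, sum_eq_add_add_sum_erase hij (fun k => y k • x k),
    edgeCoord_self hij, edgeCoord_right, Function.update_self, Function.update_of_ne hij.symm,
    ← add_assoc, ← add_assoc]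
  congr 1
  · rw [smul_add, smul_smul, smul_smul, add_assoc, ← add_smul]
    congr 2 <;> field_simp
    ring
  · refine Finset.sum_congr rfl fun k hk => ?_
    simp only [Finset.mem_erase, Finset.mem_univ, and_true] at hk
    rw [edgeCoord_of_ne l y hk.2 hk.1, Function.update_of_ne hk.2]

/-- Hence every function `t * g (∑ yᵢ)` satisfies the edge equation, since `(1 - l) t + l t = t`. -/
theorem sum_edgeCoord {i j : ι} (hij : i ≠ j) {l : ℝ} (hl : l < 1) (y : ι → ℝ) :
    ∑ k, edgeCoord i j l y k = ∑ k, y k := by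
  have := sum_edgeCoord_smul hij hl y fun _ => (1 : ℝ)
  have h1 : Function.update (fun _ => (1 : ℝ)) i ((1 - l) • (1 : ℝ) + l • (1 : ℝ)) =
      fun _ : ι => (1 : ℝ) := by
    ext k
    by_cases h : k = i <;> simp [h]
  rw [h1] at this
  simpa using this

/-- Homogeneity covers the coordinate axes, and `EdgeEquation.opposite_signs` covers two nonzero
coordinates of opposite sign and unequal size, with continuity for equal size. Everything else has
two coordinates of the same sign, and a suitable cut kills one of them in each half. -/
theorem EdgeEquation.eq_zero {G : ℝ → (ι → ℝ) → ℝ} (hG : EdgeEquation G) {p : ℝ} (hp : 0 < p)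
    (hcont : ∀ t, 0 < t → Continuous (G t))
    (hhom : ∀ t, 0 < t → ∀ r : ℝ, 0 < r → ∀ y, G t (r • y) = r ^ p * G t y)
    (hpos : ∀ t, 0 < t → ∀ i, G t (Pi.single i 1) = 0)
    (hneg : ∀ t, 0 < t → ∀ i, G t (Pi.single i (-1)) = 0) {t : ℝ} (ht : 0 < t) (y : ι → ℝ) :
    G t y = 0 := by
  have hzero : ∀ t, 0 < t → G t 0 = 0 := by
    intro t ht
    have h := hhom t ht 2 two_pos 0
    rw [smul_zero] at h
    have h2 : (1 : ℝ) < 2 ^ p := Real.one_lt_rpow one_lt_two hp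
    nlinarith [mul_eq_zero.1 (show (2 ^ p - 1) * G t 0 = 0 by linarith)|>.resolve_left
      (by linarith)]
  have hsingle : ∀ t, 0 < t → ∀ i c, G t (Pi.single i c) = 0 := by
    intro t ht i c
    rcases lt_trichotomy c 0 with hc | rfl | hc
    · have : (Pi.single i c : ι → ℝ) = (-c) • Pi.single i (-1) := by
        rw [← Pi.single_smul]; simp
      rw [this, hhom t ht _ (neg_pos.2 hc), hneg t ht, mul_zero]
    · rw [Pi.single_zero]
      exact hzero t ht
    · have : (Pi.single i c : ι → ℝ) = c • Pi.single i 1 := by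
        rw [← Pi.single_smul]; simp
      rw [this, hhom t ht _ hc, hpos t ht, mul_zero]
  have hgap : ∀ t, 0 < t → ∀ i j, i ≠ j → ∀ a b : ℝ, a * b < 0 → |b| < |a| →
      G t (Pi.single i a + Pi.single j b) = 0 := by
    intro t ht i j hij a b hab hlt
    have hne : a + b ≠ 0 := by
      intro h
      rw [eq_neg_of_add_eq_zero_left h, abs_neg] at hlt
      exact lt_irrefl _ hlt
    -- The values `c = a + b` and `-b / (a + b)` solve the two equations that match `opposite_signs`
    -- with the coordinates `a` and `b`.
    have hb : 0 < -b / (a + b) := by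
      rcases lt_or_ge 0 a with ha | ha
      · have : b < 0 := by nlinarith
        rw [abs_of_pos ha, abs_of_neg this] at hlt
        exact div_pos (by linarith) (by linarith)
      · have ha' : a < 0 := lt_of_le_of_ne ha (by rintro rfl; simp at hab)
        have : 0 < b := by nlinarith
        rw [abs_of_neg ha', abs_of_pos this] at hlt
        exact div_pos_of_neg_of_neg (by linarith) (by linarith)
    have h := hG.opposite_signs hij (c := a + b) (fun t ht => hsingle t ht i _) ht hb
    have e1 : (1 + -b / (a + b)) * (a + b) = a := by field_simp; ring
    have e2 : -(-b / (a + b) * (a + b)) = b := by field_simp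
    rwa [e1, e2] at h
  have hopp : ∀ t, 0 < t → ∀ i j, i ≠ j → ∀ a b : ℝ, a * b < 0 →
      G t (Pi.single i a + Pi.single j b) = 0 := by
    intro t ht i j hij a b hab
    rcases lt_trichotomy |b| |a| with h | h | h
    · exact hgap t ht i j hij a b hab h
    · have hlim : Filter.Tendsto
          (fun e : ℝ => G t (Pi.single i (a * (1 + e)) + Pi.single j b))
          (nhdsWithin 0 (Set.Ioi 0)) (nhds (G t (Pi.single i (a * (1 + 0)) + Pi.single j b))) := by
        have hc : Continuous fun e : ℝ => G t (Pi.single i (a * (1 + e)) + Pi.single j b) := by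
          refine (hcont t ht).comp (Continuous.add ?_ continuous_const)
          exact (continuous_single i).comp (by fun_prop)
        exact (hc.tendsto 0).mono_left nhdsWithin_le_nhds
      have hev : (fun e : ℝ => G t (Pi.single i (a * (1 + e)) + Pi.single j b)) =ᶠ[
          nhdsWithin 0 (Set.Ioi 0)] fun _ => 0 := by
        filter_upwards [self_mem_nhdsWithin] with e he
        have he : 0 < e := he
        refine hgap t ht i j hij _ b ?_ ?_
        · nlinarith
        · rw [abs_mul, h, abs_of_pos (by linarith : 0 < 1 + e)]
          have : 0 < |a| := abs_pos.2 (by rintro rfl; simp at hab)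
          nlinarith
      have := tendsto_nhds_unique (hlim.congr' hev) tendsto_const_nhds
      simpa using this
    · rw [add_comm]
      exact hgap t ht j i hij.symm b a (by linarith) h
  -- For `yᵢ`, `yⱼ` of the same sign, `l = yⱼ / (yᵢ + yⱼ)` makes the cut point parallel to `yᵢ xᵢ +
  -- yⱼ xⱼ`, so one coordinate vanishes in each half. Three nonzero coordinates cannot have pairwise
  -- opposite signs.
  induction hm : (Finset.univ.filter fun i => y i ≠ 0).card using Nat.strong_induction_on
    generalizing t y with
  | _ m ih =>
  subst hm
  by_cases hex : ∃ i j, i ≠ j ∧ 0 < y i * y j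
  · obtain ⟨i, j, hij, hmul⟩ := hex
    have hi : y i ≠ 0 := by rintro h; simp [h] at hmul
    have hj : y j ≠ 0 := by rintro h; simp [h] at hmul
    have hs : y i + y j ≠ 0 := by
      intro h
      have : y i = -y j := by linarith
      rw [this] at hmul
      nlinarith [sq_nonneg (y j)]
    have hpos' : ∀ a b : ℝ, 0 < a * b → a + b ≠ 0 → 0 < b / (a + b) := by
      intro a b h hs
      have h1 : b / (a + b) = (a * b + b * b) / ((a + b) * (a + b)) := by field_simp
      rw [h1]
      exact div_pos (by nlinarith [mul_self_nonneg b]) (mul_self_pos.2 hs)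
    have hl0 : 0 < y j / (y i + y j) := hpos' _ _ hmul hs
    have hl1 : 1 - y j / (y i + y j) = y i / (y i + y j) := by field_simp; ring
    have hl1' : y j / (y i + y j) < 1 := by
      have : 0 < y i / (y j + y i) := hpos' _ _ (by linarith) (by rwa [add_comm])
      rw [add_comm (y j), ← hl1] at this
      linarith
    have hlt : ∀ a b, a ≠ b → y a ≠ 0 → y b ≠ 0 → ∀ l, edgeCoord a b l y b = 0 →
        (Finset.univ.filter fun k => edgeCoord a b l y k ≠ 0).card <
          (Finset.univ.filter fun k => y k ≠ 0).card := by
      intro a b hab ha hb l h0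
      refine Finset.card_lt_card (Finset.ssubset_iff_subset_ne.2 ⟨fun k => ?_, fun h => ?_⟩)
      · simp only [Finset.mem_filter, Finset.mem_univ, true_and]
        intro hk
        by_cases hkb : k = b
        · rwa [hkb]
        · by_cases hka : k = a
          · rwa [hka]
          · rwa [edgeCoord_of_ne l y hka hkb] at hk
      · have : b ∈ Finset.univ.filter fun k => y k ≠ 0 := by simp [hb]
        rw [← h] at this
        simp [h0] at this
    rw [hG t ht i j hij _ hl0 hl1' y,
      ih _ (hlt i j hij hi hj _ ?_) (mul_pos (by linarith) ht) _ rfl,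
      ih _ (hlt j i hij.symm hj hi _ ?_) (mul_pos hl0 ht) _ rfl, add_zero]
    · rw [edgeCoord_right, sub_sub_cancel, hl1]
      field_simp
      ring
    · rw [edgeCoord_right, hl1]
      field_simp
      ring
  · push Not at hex
    by_cases hy : y = 0
    · rw [hy]; exact hzero t ht
    obtain ⟨i, hi⟩ := Function.ne_iff.1 hy
    rw [Pi.zero_apply] at hi
    by_cases hex2 : ∃ j, j ≠ i ∧ y j ≠ 0
    · obtain ⟨j, hji, hj⟩ := hex2
      have hneg' : y i * y j < 0 := lt_of_le_of_ne (hex i j hji.symm) (mul_ne_zero hi hj)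
      have : y = Pi.single i (y i) + Pi.single j (y j) := by
        ext k
        by_cases hki : k = i
        · subst hki; simp [hji.symm]
        by_cases hkj : k = j
        · subst hkj; simp [hji]
        simp only [Pi.add_apply, Pi.single_eq_of_ne hki, Pi.single_eq_of_ne hkj, add_zero]
        by_contra hk
        have h1 : y i * y k < 0 := lt_of_le_of_ne (hex i k (Ne.symm hki)) (mul_ne_zero hi hk)
        have h2 : y j * y k < 0 := lt_of_le_of_ne (hex j k (Ne.symm hkj)) (mul_ne_zero hj hk)
        nlinarith [mul_pos_of_neg_of_neg h1 h2, mul_self_pos.2 hk]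
      rw [this]
      exact hopp t ht i j hji.symm _ _ hneg'
    · push Not at hex2
      have : y = Pi.single i (y i) := by
        ext k
        by_cases hki : k = i
        · subst hki; simp
        · rw [Pi.single_eq_of_ne hki, hex2 k hki]
      rw [this]
      exact hsingle t ht i _

end FunctionalEquation

/-! ### Cauchy's equation on the positive reals. -/

section Cauchy

theorem exists_addMonoidHom_of_add_pos {h : ℝ → ℝ}
    (hadd : ∀ s t, 0 < s → 0 < t → h (s + t) = h s + h t) :
    ∃ H : ℝ →+ ℝ, ∀ t, 0 < t → H t = h t := by
  have key : ∀ a b c d : ℝ, 0 < a → 0 < b → 0 < c → 0 < d → a - b = c - d →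
      h a - h b = h c - h d := by
    intro a b c d ha hb hc hd he
    have h1 := hadd a d ha hd
    have h2 := hadd b c hb hc
    rw [show a + d = b + c by linarith] at h1
    linarith
  -- Each `x` is written as a difference of two positive numbers; by `key` the choice does not
  -- matter.
  let H : ℝ → ℝ := fun x => h (|x| + 1 + x) - h (|x| + 1)
  have hpos : ∀ x : ℝ, 0 < |x| + 1 + x ∧ 0 < |x| + 1 := fun x =>
    ⟨by linarith [neg_abs_le x], by positivity⟩
  refine ⟨AddMonoidHom.mk' H fun x y => ?_, fun t ht => ?_⟩
  · have h1 := key (|x + y| + 1 + (x + y)) (|x + y| + 1) ((|x| + 1 + x) + (|y| + 1 + y))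
      ((|x| + 1) + (|y| + 1)) (hpos _).1 (hpos _).2 (add_pos (hpos x).1 (hpos y).1)
      (add_pos (hpos x).2 (hpos y).2) (by ring)
    simp only [H]
    rw [h1, hadd _ _ (hpos x).1 (hpos y).1, hadd _ _ (hpos x).2 (hpos y).2]
    ring
  · change h (|t| + 1 + t) - h (|t| + 1) = h t
    rw [hadd _ _ (hpos t).2 ht]
    ring

/-- The graph of a discontinuous additive function is dense in the plane. -/
theorem AddMonoidHom.denseRange_graph (H : ℝ →+ ℝ) {t : ℝ} (ht : H t ≠ t * H 1) :
    DenseRange fun x : ℝ => (x, H x) := by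
  have h1 : DenseRange fun r : ℚ × ℚ => ((r.1 : ℝ), (r.2 : ℝ)) :=
    Rat.isDenseEmbedding_coe_real.dense.prodMap Rat.isDenseEmbedding_coe_real.dense
  -- The vectors `(1, H 1)` and `(t, H t)` are independent by hypothesis, and by `ℚ`-linearity their
  -- rational combinations lie on the graph.
  let A : ℝ × ℝ → ℝ × ℝ := fun r => (r.1 + r.2 * t, r.1 * H 1 + r.2 * H t)
  have hA : Function.Surjective A := by
    rintro ⟨a, b⟩
    have hd : H t - t * H 1 ≠ 0 := sub_ne_zero.2 ht
    refine ⟨((a * H t - b * t) / (H t - t * H 1), (b - a * H 1) / (H t - t * H 1)), ?_⟩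
    simp only [A, Prod.mk.injEq]
    constructor <;> field_simp <;> ring
  have h2 := hA.denseRange.comp h1 (by fun_prop)
  refine h2.mono ?_
  rintro _ ⟨r, rfl⟩
  refine ⟨r.1 + r.2 * t, ?_⟩
  have e : ∀ (q : ℚ) (x : ℝ), H (q * x) = q * H x := by
    intro q x
    have := map_rat_smul H q x
    rwa [Rat.smul_def, Rat.smul_def] at this
  have e1 : H r.1 = r.1 * H 1 := by
    have := e r.1 1
    rwa [mul_one] at this
  simp only [A, Function.comp_apply, map_add, e, e1]

/-- If `h` were not linear, its dense graph, carried by the continuous change of variables `ψ`,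
would have dense values over `(a, b)`. The expression `s ^ (-p) * h (s ^ n)` arises since the
simplex `s Tⁿ` has determinant `s ^ n` and its vertex coordinates are scaled by `s`. -/
theorem linear_of_add_of_not_dense {h : ℝ → ℝ} {n : ℕ} (hn : n ≠ 0) (p : ℝ)
    (hadd : ∀ s t, 0 < s → 0 < t → h (s + t) = h s + h t) {a b : ℝ} (ha : 0 ≤ a) (hab : a < b)
    (hd : ¬ Dense ((fun s : ℝ => s ^ (-p) * h (s ^ n)) '' Set.Ioo a b)) {t : ℝ} (ht : 0 < t) :
    h t = t * h 1 := by
  obtain ⟨H, hH⟩ := exists_addMonoidHom_of_add_pos hadd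
  rw [← hH t ht, ← hH 1 one_pos]
  by_contra hne
  apply hd
  have hdense := H.denseRange_graph hne
  rw [dense_iff_inter_open]
  rintro V hV ⟨η, hη⟩
  obtain ⟨s, hsa, hsb⟩ := exists_between hab
  have hs : 0 < s := ha.trans_lt hsa
  let ψ : ℝ × ℝ → ℝ × ℝ := fun q => (q.1 ^ (1 / (n : ℝ)), (q.1 ^ (1 / (n : ℝ))) ^ (-p) * q.2)
  have hroot : (s ^ n) ^ (1 / (n : ℝ)) = s := by
    rw [one_div, Real.pow_rpow_inv_natCast hs.le hn]
  have hsn : 0 < s ^ n := pow_pos hs n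
  have hψ : ContinuousAt ψ (s ^ n, s ^ p * η) := by
    have h1 : ContinuousAt (fun q : ℝ × ℝ => q.1 ^ (1 / (n : ℝ))) (s ^ n, s ^ p * η) :=
      continuousAt_fst.rpow_const (Or.inl hsn.ne')
    refine h1.prodMk ((h1.rpow_const (Or.inl ?_)).mul continuousAt_snd)
    simp only [hroot]
    exact hs.ne'
  have hψs : ψ (s ^ n, s ^ p * η) = (s, η) := by
    simp only [ψ, hroot, Prod.mk.injEq, true_and]
    rw [← mul_assoc, ← Real.rpow_add hs, neg_add_cancel, Real.rpow_zero, one_mul]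
  have hnhds : Set.Ioo a b ×ˢ V ∈ nhds (ψ (s ^ n, s ^ p * η)) := by
    rw [hψs]
    exact prod_mem_nhds (Ioo_mem_nhds hsa hsb) (hV.mem_nhds hη)
  have hev := (hψ.eventually_mem hnhds).and
    (continuousAt_fst.eventually_mem (Ioi_mem_nhds hsn))
  obtain ⟨_, ⟨x, rfl⟩, ⟨hxI, hxV⟩, hx⟩ := Dense.inter_nhds_nonempty hdense hev
  have hx : 0 < x := hx
  refine ⟨_, hxV, x ^ (1 / (n : ℝ)), hxI, ?_⟩
  have hpow : (x ^ (1 / (n : ℝ))) ^ n = x := by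
    rw [one_div, Real.rpow_inv_natCast_pow hx.le hn]
  simp only [ψ, hpow, hH x hx]

end Cauchy

/-! ### Simple `SL(n)`-contravariant valuations -/

section Valuation

variable {n : ℕ} {p : ℝ} {Φ : ConvexPolytope n → Cp n p}

theorem ConvexPolytope.dim_lt_of_flat {P : ConvexPolytope n}
    {f : EuclideanSpace ℝ (Fin n) →ₗ[ℝ] ℝ} (hf : f ≠ 0) {c : ℝ} (h : ∀ x ∈ P.carrier, f x = c) :
    P.dim < n := by
  have hle : vectorSpan ℝ P.carrier ≤ LinearMap.ker f := by
    refine Submodule.span_le.2 ?_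
    rintro _ ⟨x, hx, y, hy, rfl⟩
    simp [h x hx, h y hy]
  have hlt : LinearMap.ker f < ⊤ := lt_top_iff_ne_top.2 fun h => hf (LinearMap.ker_eq_top.1 h)
  have h1 := Submodule.finrank_mono hle
  have h2 := Submodule.finrank_lt hlt.ne
  rw [finrank_euclideanSpace_fin] at h2
  exact h1.trans_lt h2

/-- The common section is flat, so simplicity removes it. It is nonempty, as a polytope must be, by
the intermediate value theorem. -/
theorem IsValuation.cut (hval : IsValuation Φ) (hsimple : IsSimple Φ) {P P₁ P₂ : ConvexPolytope n}
    {f : EuclideanSpace ℝ (Fin n) →ₗ[ℝ] ℝ} (hf : f ≠ 0) {c : ℝ}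
    (hP₁ : P₁.carrier = P.carrier ∩ {x | f x ≤ c})
    (hP₂ : P₂.carrier = P.carrier ∩ {x | c ≤ f x}) : Φ P = Φ P₁ + Φ P₂ := by
  have hne : (P₁.carrier ∩ P₂.carrier).Nonempty := by
    obtain ⟨x, hx⟩ := P₁.nonempty
    obtain ⟨y, hy⟩ := P₂.nonempty
    rw [hP₁] at hx
    rw [hP₂] at hy
    obtain ⟨z, hz, hzc⟩ := P.isHull.convex.isPreconnected.intermediate_value hx.1 hy.1
      (f := f) f.continuous_of_finiteDimensional.continuousOn ⟨hx.2, hy.2⟩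
    exact ⟨z, hP₁ ▸ ⟨hz, hzc.le⟩, hP₂ ▸ ⟨hz, hzc.ge⟩⟩
  have hhull : IsHull (P₁.carrier ∩ P₂.carrier) := by
    rw [hP₂, ← Set.inter_assoc]
    have : P₁.carrier ∩ P.carrier = P₁.carrier :=
      Set.inter_eq_left.2 (hP₁ ▸ Set.inter_subset_left)
    rw [this]
    exact P₁.isHull.inter_ge f c
  obtain ⟨I, hI⟩ := ConvexPolytope.exists_carrier_eq hhull hne
  have hunion : P.carrier = P₁.carrier ∪ P₂.carrier := by
    rw [hP₁, hP₂, ← Set.inter_union_distrib_left, eq_comm, Set.inter_eq_left]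
    exact fun x _ => le_total (f x) c
  have h := hval P₁ P₂ P I hunion hI
  rw [hsimple I (ConvexPolytope.dim_lt_of_flat hf (c := c) fun x hx => ?_), add_zero] at h
  · exact h
  · rw [hI, hP₁, hP₂] at hx
    exact le_antisymm hx.1.2 hx.2.2

theorem IsValuation.cut_apply (hval : IsValuation Φ) (hsimple : IsSimple Φ)
    {P P₁ P₂ : ConvexPolytope n} {f : EuclideanSpace ℝ (Fin n) →ₗ[ℝ] ℝ} (hf : f ≠ 0) {c : ℝ}
    (hP₁ : P₁.carrier = P.carrier ∩ {x | f x ≤ c})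
    (hP₂ : P₂.carrier = P.carrier ∩ {x | c ≤ f x}) (u : EuclideanSpace ℝ (Fin n)) :
    (Φ P).1 u = (Φ P₁).1 u + (Φ P₂).1 u := by
  rw [hval.cut hsimple hf hP₁ hP₂]
  rfl

/-- The polytope underlying a corner simplex. -/
def cornerPolytope (x : Fin n → EuclideanSpace ℝ (Fin n)) : ConvexPolytope n where
  carrier := cornerSimplex x
  exists_finset' := by
    classical
    exact ⟨insert 0 (Finset.univ.image x), Finset.insert_nonempty _ _, by simp [cornerSimplex]⟩

theorem IsValuation.edge_cut_apply (hval : IsValuation Φ) (hsimple : IsSimple Φ)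
    {x : Fin n → EuclideanSpace ℝ (Fin n)} (hx : LinearIndependent ℝ x) {i j : Fin n}
    (hij : i ≠ j) {l : ℝ} (hl0 : 0 < l) (hl1 : l < 1) (u : EuclideanSpace ℝ (Fin n)) :
    (Φ (cornerPolytope x)).1 u =
      (Φ (cornerPolytope (Function.update x i ((1 - l) • x i + l • x j)))).1 u +
      (Φ (cornerPolytope (Function.update x j ((1 - l) • x i + l • x j)))).1 u := by
  obtain ⟨f, hf, hi, hj, hk⟩ := exists_edge_functional hx (by simp) hij hl0
  exact hval.cut_apply hsimple hf (cornerSimplex_inter_le x hij hl0 hl1 f hi hj hk).symm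
    (cornerSimplex_inter_ge x hij hl0 hl1 f hi hj hk).symm u

theorem vecDet_update {x : Fin n → EuclideanSpace ℝ (Fin n)} {i j : Fin n} (hij : i ≠ j)
    (a b : ℝ) : vecDet (Function.update x i (a • x i + b • x j)) = a * vecDet x := by
  let M : Matrix (Fin n) (Fin n) ℝ := Matrix.of fun i j => x i j
  have h1 : (Matrix.of fun k m => Function.update x i (a • x i + b • x j) k m) =
      M.updateRow i (a • M i + b • M j) := by
    ext k m
    by_cases hk : k = i
    · subst hk; simp [M]
    · simp [M, hk]
  rw [vecDet, h1, Matrix.det_updateRow_add, Matrix.det_updateRow_smul, Matrix.det_updateRow_smul,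
    Matrix.updateRow_eq_self, Matrix.det_updateRow_eq_zero hij.symm, mul_zero, add_zero]
  rfl

theorem vecDet_comp_perm (x : Fin n → EuclideanSpace ℝ (Fin n)) (σ : Equiv.Perm (Fin n)) :
    vecDet (x ∘ σ) = (Equiv.Perm.sign σ : ℤ) * vecDet x :=
  Matrix.det_permute σ (Matrix.of fun i j => x i j)

/-- The value of `Φ` on a corner simplex of determinant `t`, at the point with coordinates `y`
with respect to the vertices. -/
noncomputable def cornerValue (Φ : ConvexPolytope n → Cp n p) (t : ℝ) (y : Fin n → ℝ) : ℝ :=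
  (Φ ((ConvexPolytope.stdSimplex n).dilate (t ^ (1 / (n : ℝ))))).1
    (t ^ (1 / (n : ℝ)) • WithLp.toLp 2 y)

/-- A corner simplex of determinant `t > 0` is the image of `t ^ (1 / n) Tⁿ` under the matrix with
columns `t ^ (-1 / n) xᵢ`, which lies in `SL(n)`. -/
theorem cornerValue_eq (hn : n ≠ 0) (hcontra : IsSLContravariant Φ)
    {x : Fin n → EuclideanSpace ℝ (Fin n)} (hx : 0 < vecDet x) (y : Fin n → ℝ) :
    (Φ (cornerPolytope x)).1 (∑ i, y i • x i) = cornerValue Φ (vecDet x) y := by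
  set s := vecDet x ^ (1 / (n : ℝ)) with hs
  have hs0 : 0 < s := Real.rpow_pos_of_pos hx _
  have hsn : s ^ n = vecDet x := by rw [hs, one_div, Real.rpow_inv_natCast_pow hx.le hn]
  let M : Matrix (Fin n) (Fin n) ℝ := s⁻¹ • (Matrix.of fun i j => x i j).transpose
  have hM : M.det = 1 := by
    rw [Matrix.det_smul, Matrix.det_transpose, Fintype.card_fin, inv_pow, hsn]
    exact inv_mul_cancel₀ hx.ne'
  let φ : Matrix.SpecialLinearGroup (Fin n) ℝ := ⟨M, hM⟩
  have hφ : ∀ y : Fin n → ℝ, Matrix.toEuclideanLin (φ : Matrix (Fin n) (Fin n) ℝ)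
      (s • WithLp.toLp 2 y) = ∑ i, y i • x i := by
    intro y
    ext k
    simp [φ, M, hs0.ne', Matrix.mulVec, dotProduct, mul_comm]
  have hcar : ((ConvexPolytope.stdSimplex n).dilate s).slImage φ = cornerPolytope x := by
    ext1
    change Matrix.toEuclideanLin (φ : Matrix (Fin n) (Fin n) ℝ) ''
      ((s • LinearMap.id : EuclideanSpace ℝ (Fin n) →ₗ[ℝ] _) ''
        cornerSimplex fun i => EuclideanSpace.single i (1 : ℝ)) = cornerSimplex x
    rw [image_cornerSimplex, image_cornerSimplex]
    congr 1
    ext1 i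
    have := hφ (Pi.single i 1)
    simpa [Pi.single_apply] using this
  rw [← hcar, hcontra, ← hφ, cornerValue, ← hs]
  congr 1
  rw [← LinearMap.comp_apply, ← Matrix.toLpLin_mul_same, ← Matrix.SpecialLinearGroup.coe_mul,
    inv_mul_cancel]
  simp

end Valuation

/-! ### Determination of `Φ` on simplices with a vertex at the origin. -/

section Classification

variable {n : ℕ} {p : ℝ} {Φ : ConvexPolytope n → Cp n p}

theorem exists_vecDet_eq (hn : n ≠ 0) {t : ℝ} (ht : 0 < t) :
    ∃ x : Fin n → EuclideanSpace ℝ (Fin n), vecDet x = t := by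
  refine ⟨fun i => t ^ (1 / (n : ℝ)) • EuclideanSpace.single i 1, ?_⟩
  have : (Matrix.of fun i j => (t ^ (1 / (n : ℝ)) •
      EuclideanSpace.single i (1 : ℝ) : EuclideanSpace ℝ (Fin n)) j) =
      (t ^ (1 / (n : ℝ))) • (1 : Matrix (Fin n) (Fin n) ℝ) := by
    ext i j
    simp [Matrix.one_apply, eq_comm]
  rw [vecDet, this, Matrix.det_smul, Matrix.det_one, mul_one, Fintype.card_fin, one_div,
    Real.rpow_inv_natCast_pow ht.le hn]

/-- The two pieces of an edge cut have determinants `(1 - l) t` and `l t`, and the evaluation point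
is rewritten in the vertex coordinates of each. -/
theorem edgeEquation_cornerValue (hn : n ≠ 0) (hval : IsValuation Φ) (hsimple : IsSimple Φ)
    (hcontra : IsSLContravariant Φ) : EdgeEquation (cornerValue Φ) := by
  intro t ht i j hij l hl0 hl1 y
  obtain ⟨x, hx⟩ := exists_vecDet_eq hn ht
  have hx0 : 0 < vecDet x := hx ▸ ht
  have h1 : vecDet (Function.update x i ((1 - l) • x i + l • x j)) = (1 - l) * t := by
    rw [vecDet_update hij, hx]
  have h2 : vecDet (Function.update x j ((1 - l) • x i + l • x j)) = l * t := by
    rw [add_comm, vecDet_update hij.symm, hx]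
  have e1 := sum_edgeCoord_smul hij hl1 y x
  have e2 := sum_edgeCoord_smul hij.symm (l := 1 - l) (by linarith) y x
  rw [sub_sub_cancel, add_comm (l • x j)] at e2
  have hcut := hval.edge_cut_apply hsimple (vecDet_ne_zero_iff.1 hx0.ne') hij hl0 hl1
    (∑ k, y k • x k)
  rw [cornerValue_eq hn hcontra hx0, hx] at hcut
  rw [hcut]
  congr 1
  · rw [← e1, cornerValue_eq hn hcontra (by rw [h1]; exact mul_pos (by linarith) ht), h1]
  · rw [← e2, cornerValue_eq hn hcontra (by rw [h2]; exact mul_pos hl0 ht), h2]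

theorem continuous_cornerValue (Φ : ConvexPolytope n → Cp n p) (t : ℝ) :
    Continuous (cornerValue Φ t) :=
  (Φ _).1.continuous.comp (by fun_prop)

theorem cornerValue_smul (Φ : ConvexPolytope n → Cp n p) (t : ℝ) {r : ℝ} (hr : 0 < r)
    (y : Fin n → ℝ) : cornerValue Φ t (r • y) = r ^ p * cornerValue Φ t y := by
  rw [cornerValue, cornerValue, WithLp.toLp_smul, smul_comm]
  exact (Φ _).2 r hr _

theorem cornerValue_comp_perm (hn : n ≠ 0) (hcontra : IsSLContravariant Φ) {t : ℝ} (ht : 0 < t)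
    (y : Fin n → ℝ) {σ : Equiv.Perm (Fin n)} (hσ : Equiv.Perm.sign σ = 1) :
    cornerValue Φ t (y ∘ σ) = cornerValue Φ t y := by
  obtain ⟨x, hx⟩ := exists_vecDet_eq hn ht
  have hxσ : vecDet (x ∘ σ) = t := by rw [vecDet_comp_perm, hσ, hx]; simp
  have hpoly : cornerPolytope (x ∘ σ) = cornerPolytope x := by
    ext1
    exact cornerSimplex_comp_equiv x σ
  have h1 := cornerValue_eq hn hcontra (hx ▸ ht) y
  have h2 := cornerValue_eq hn hcontra (hxσ ▸ ht) (y ∘ σ)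
  rw [hx] at h1
  rw [hxσ, hpoly] at h2
  rw [← h1, ← h2]
  congr 1
  exact Equiv.sum_comp σ fun i => y i • x i

theorem exists_ne_ne (hn : 3 ≤ n) (i j : Fin n) : ∃ k, k ≠ i ∧ k ≠ j := by
  have : ({i, j} : Finset (Fin n)).card < Fintype.card (Fin n) := by
    rw [Fintype.card_fin]
    exact Finset.card_le_two.trans_lt hn
  obtain ⟨k, hk⟩ := Finset.exists_mem_notMem_of_card_lt_card (s := {i, j}) (t := Finset.univ) this
  simp only [Finset.mem_insert, Finset.mem_singleton, not_or] at hk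
  exact ⟨k, hk.2⟩

/-- A third index `k` completes the swap of `i` and `j` to an even permutation. -/
theorem cornerValue_single_eq (hn : 3 ≤ n) (hcontra : IsSLContravariant Φ) {t : ℝ} (ht : 0 < t)
    (i j : Fin n) (c : ℝ) :
    cornerValue Φ t (Pi.single i c) = cornerValue Φ t (Pi.single j c) := by
  rcases eq_or_ne i j with rfl | hij
  · rfl
  obtain ⟨k, hki, hkj⟩ := exists_ne_ne hn i j
  let σ : Equiv.Perm (Fin n) := Equiv.swap i j * Equiv.swap i k
  have hsign : Equiv.Perm.sign σ = 1 := by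
    rw [Equiv.Perm.sign_mul, Equiv.Perm.sign_swap hij, Equiv.Perm.sign_swap hki.symm]
    rfl
  have hσ : (Pi.single i c : Fin n → ℝ) ∘ σ = Pi.single j c := by
    have hj : σ j = i := by simp [σ, Equiv.swap_apply_of_ne_of_ne hij.symm hkj.symm]
    ext m
    by_cases hm : m = j
    · subst hm; simp [hj]
    · have : σ m ≠ i := fun h => hm (σ.injective (h.trans hj.symm))
      simp [hm, this]
  rw [← hσ, cornerValue_comp_perm (by omega) hcontra ht _ hsign]

/-- Cutting the edge between two vertices other than `x i` does not change the coordinates of `c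
eᵢ`, so the edge equation becomes additivity in `t`. -/
theorem cornerValue_single_linear (hn : 3 ≤ n) (hval : IsValuation Φ) (hsimple : IsSimple Φ)
    (hcontra : IsSLContravariant Φ)
    (hdens : ∀ y : EuclideanSpace ℝ (Fin n), ∃ a b : ℝ, 0 ≤ a ∧ a < b ∧
      ¬ Dense ((fun s : ℝ => (Φ ((ConvexPolytope.stdSimplex n).dilate s)).1 y) '' Set.Ioo a b))
    {t : ℝ} (ht : 0 < t) (i : Fin n) (c : ℝ) :
    cornerValue Φ t (Pi.single i c) = t * cornerValue Φ 1 (Pi.single i c) := by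
  have hn0 : n ≠ 0 := by omega
  obtain ⟨j, hji, -⟩ := exists_ne_ne hn i i
  obtain ⟨k, hki, hkj⟩ := exists_ne_ne hn i j
  obtain ⟨a, b, ha, hab, hd⟩ := hdens (WithLp.toLp 2 (Pi.single i c))
  refine linear_of_add_of_not_dense (h := fun t => cornerValue Φ t (Pi.single i c)) hn0 p ?_ ha hab
    ?_ ht
  · intro s t hs ht
    have hst : 0 < s + t := add_pos hs ht
    have h := edgeEquation_cornerValue hn0 hval hsimple hcontra (s + t) hst j k hkj.symm
      (t / (s + t)) (div_pos ht hst) ((div_lt_one hst).2 (by linarith)) (Pi.single i c)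
    rw [edgeCoord_eq_self _ (by simp [hji]), edgeCoord_eq_self _ (by simp [hki])] at h
    have e1 : (1 - t / (s + t)) * (s + t) = s := by field_simp; ring
    have e2 : t / (s + t) * (s + t) = t := by field_simp
    rwa [e1, e2] at h
  · refine fun hdense => hd ?_
    refine (Set.image_congr fun s hs => ?_) ▸ hdense
    have hs0 : 0 < s := ha.trans_lt hs.1
    have hroot : (s ^ n) ^ (1 / (n : ℝ)) = s := by
      rw [one_div, Real.pow_rpow_inv_natCast hs0.le hn0]
    simp only [cornerValue, hroot]
    rw [(Φ _).2 s hs0, ← mul_assoc, ← Real.rpow_add hs0, neg_add_cancel, Real.rpow_zero, one_mul]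

/-- The candidate `S` also satisfies the edge equation and agrees with `cornerValue Φ` at `±eᵢ`, so
their difference vanishes. -/
theorem cornerValue_formula (hn : 3 ≤ n) (hp : 0 < p) (hval : IsValuation Φ)
    (hsimple : IsSimple Φ) (hcontra : IsSLContravariant Φ)
    (hdens : ∀ y : EuclideanSpace ℝ (Fin n), ∃ a b : ℝ, 0 ≤ a ∧ a < b ∧
      ¬ Dense ((fun s : ℝ => (Φ ((ConvexPolytope.stdSimplex n).dilate s)).1 y) '' Set.Ioo a b)) :
    ∃ c₁ c₂ : ℝ, ∀ t, 0 < t → ∀ y : Fin n → ℝ, cornerValue Φ t y =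
      t * (c₁ * max (∑ i, y i) 0 ^ p + c₂ * max (-∑ i, y i) 0 ^ p) := by
  have hn0 : n ≠ 0 := by omega
  let i₀ : Fin n := ⟨0, by omega⟩
  let c₁ := cornerValue Φ 1 (Pi.single i₀ 1)
  let c₂ := cornerValue Φ 1 (Pi.single i₀ (-1))
  let S : ℝ → (Fin n → ℝ) → ℝ := fun t y =>
    t * (c₁ * max (∑ i, y i) 0 ^ p + c₂ * max (-∑ i, y i) 0 ^ p)
  have hlin : ∀ t, 0 < t → ∀ i c, cornerValue Φ t (Pi.single i c) =
      t * cornerValue Φ 1 (Pi.single i₀ c) := fun t ht i c => by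
    rw [cornerValue_single_eq hn hcontra ht i i₀,
      cornerValue_single_linear hn hval hsimple hcontra hdens ht]
  have hEdge : EdgeEquation fun t y => cornerValue Φ t y - S t y := by
    intro t ht i j hij l hl0 hl1 y
    simp only [S]
    rw [edgeEquation_cornerValue hn0 hval hsimple hcontra t ht i j hij l hl0 hl1 y,
      sum_edgeCoord hij hl1, sum_edgeCoord hij.symm (by linarith)]
    ring
  refine ⟨c₁, c₂, fun t ht y => sub_eq_zero.1 ?_⟩
  refine hEdge.eq_zero hp ?_ ?_ ?_ ?_ ht y
  · intro t _
    refine (continuous_cornerValue Φ t).sub (continuous_const.mul (.add ?_ ?_))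
    · exact continuous_const.mul (Continuous.rpow_const (by fun_prop) fun _ => Or.inr hp.le)
    · exact continuous_const.mul (Continuous.rpow_const (by fun_prop) fun _ => Or.inr hp.le)
  · intro t _ r hr y
    have e : ∀ z : ℝ, max (r * z) 0 ^ p = r ^ p * max z 0 ^ p := fun z => by
      rw [← Real.mul_rpow hr.le (le_max_right _ _), mul_max_of_nonneg _ _ hr.le, mul_zero]
    simp only [S, cornerValue_smul Φ t hr, Pi.smul_apply, smul_eq_mul, ← Finset.mul_sum]
    rw [e, ← mul_neg, e]
    ring
  · intro t ht i
    simp [S, hlin t ht i, Real.zero_rpow hp.ne', c₁]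
  · intro t ht i
    simp [S, hlin t ht i, Real.zero_rpow hp.ne', c₂]

/-- For negative determinant, a transposition of two vertices changes the sign of the determinant
but not the simplex. -/
theorem apply_cornerPolytope (hn : 3 ≤ n) (hcontra : IsSLContravariant Φ) {c₁ c₂ : ℝ}
    (hc : ∀ t, 0 < t → ∀ y : Fin n → ℝ, cornerValue Φ t y =
      t * (c₁ * max (∑ i, y i) 0 ^ p + c₂ * max (-∑ i, y i) 0 ^ p))
    {x : Fin n → EuclideanSpace ℝ (Fin n)} (hx : LinearIndependent ℝ x) (y : Fin n → ℝ) :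
    (Φ (cornerPolytope x)).1 (∑ i, y i • x i) =
      |vecDet x| * (c₁ * max (∑ i, y i) 0 ^ p + c₂ * max (-∑ i, y i) 0 ^ p) := by
  have hn0 : n ≠ 0 := by omega
  rcases (vecDet_ne_zero_iff.2 hx).lt_or_gt with h | h
  · let σ : Equiv.Perm (Fin n) := Equiv.swap ⟨0, by omega⟩ ⟨1, by omega⟩
    have hσ : vecDet (x ∘ σ) = -vecDet x := by
      rw [vecDet_comp_perm, Equiv.Perm.sign_swap (by simp)]
      simp
    have hpoly : cornerPolytope (x ∘ σ) = cornerPolytope x := by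
      ext1
      exact cornerSimplex_comp_equiv x σ
    have h1 := cornerValue_eq hn0 hcontra (x := x ∘ σ) (by rw [hσ]; linarith) (y ∘ σ)
    rw [hpoly, hσ, hc _ (by linarith)] at h1
    have e1 : ∑ i, (y ∘ σ) i • (x ∘ σ) i = ∑ i, y i • x i := Equiv.sum_comp σ fun i => y i • x i
    have e2 : ∑ i, (y ∘ σ) i = ∑ i, y i := Equiv.sum_comp σ y
    rw [e1, e2] at h1
    rw [h1, abs_of_neg h]
  · rw [cornerValue_eq hn0 hcontra h, hc _ h, abs_of_pos h]

end Classification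

/-! ### From functions on polytopes to dissective set functions, and the conclusion. -/

section Extension

variable {n : ℕ}

open Classical in
/-- The extension by zero of a function on polytopes to all sets. -/
noncomputable def extendByZero (ν : ConvexPolytope n → ℝ) (A : Set (EuclideanSpace ℝ (Fin n))) :
    ℝ :=
  if h : ∃ P : ConvexPolytope n, P.carrier = A then ν h.choose else 0

theorem extendByZero_carrier (ν : ConvexPolytope n → ℝ) (P : ConvexPolytope n) :
    extendByZero ν P.carrier = ν P := by
  have h : ∃ Q : ConvexPolytope n, Q.carrier = P.carrier := ⟨P, rfl⟩
  rw [extendByZero, dif_pos h, ConvexPolytope.ext h.choose_spec]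

theorem extendByZero_empty (ν : ConvexPolytope n → ℝ) : extendByZero ν ∅ = 0 := by
  rw [extendByZero, dif_neg]
  rintro ⟨P, hP⟩
  exact P.nonempty.ne_empty hP

/-- The value `0` at the empty set makes additivity hold also for hyperplanes that miss the interior
of the cut, where one piece is empty and not a polytope. -/
theorem isDissective_extendByZero {ν : ConvexPolytope n → ℝ}
    (hcut : ∀ P P₁ P₂ : ConvexPolytope n, ∀ f : EuclideanSpace ℝ (Fin n) →ₗ[ℝ] ℝ, f ≠ 0 → ∀ c,
      P₁.carrier = P.carrier ∩ {x | f x ≤ c} → P₂.carrier = P.carrier ∩ {x | c ≤ f x} →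
      ν P = ν P₁ + ν P₂)
    (hflat : ∀ P : ConvexPolytope n, ∀ f : EuclideanSpace ℝ (Fin n) →ₗ[ℝ] ℝ, f ≠ 0 → ∀ c,
      (∀ x ∈ P.carrier, f x = c) → ν P = 0) : IsDissective (extendByZero ν) where
  cut A hA f hf c := by
    have hunion : A ∩ {x | f x ≤ c} ∪ A ∩ {x | c ≤ f x} = A := by
      rw [← Set.inter_union_distrib_left, Set.inter_eq_left]
      exact fun x _ => le_total (f x) c
    rcases (A ∩ {x | f x ≤ c}).eq_empty_or_nonempty with h1 | h1
    · rw [h1, Set.empty_union] at hunion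
      rw [h1, extendByZero_empty, zero_add, hunion]
    rcases (A ∩ {x | c ≤ f x}).eq_empty_or_nonempty with h2 | h2
    · rw [h2, Set.union_empty] at hunion
      rw [h2, extendByZero_empty, add_zero, hunion]
    obtain ⟨P, rfl⟩ := ConvexPolytope.exists_carrier_eq hA (h1.mono Set.inter_subset_left)
    obtain ⟨P₁, hP₁⟩ := ConvexPolytope.exists_carrier_eq (hA.inter_le f c) h1
    obtain ⟨P₂, hP₂⟩ := ConvexPolytope.exists_carrier_eq (hA.inter_ge f c) h2
    rw [← hP₁, ← hP₂, extendByZero_carrier, extendByZero_carrier, extendByZero_carrier]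
    exact hcut P P₁ P₂ f hf c hP₁ hP₂
  flat A hA f hf c h := by
    rcases A.eq_empty_or_nonempty with rfl | hne
    · exact extendByZero_empty ν
    obtain ⟨P, rfl⟩ := ConvexPolytope.exists_carrier_eq hA hne
    rw [extendByZero_carrier]
    exact hflat P f hf c h

theorem exists_unit_normal {f : EuclideanSpace ℝ (Fin n) →ₗ[ℝ] ℝ} (hf : f ≠ 0) :
    ∃ w : EuclideanSpace ℝ (Fin n), ∃ r : ℝ, 0 < r ∧ ‖w‖ = 1 ∧ ∀ x, f x = r * inner ℝ x w := by
  let w := (InnerProductSpace.toDual ℝ _).symm f.toContinuousLinearMap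
  have hw : ∀ x, f x = inner ℝ x w := fun x => by
    rw [real_inner_comm, InnerProductSpace.toDual_symm_apply]
    rfl
  have hw0 : w ≠ 0 := fun h => hf (LinearMap.ext fun x => by rw [hw, h, inner_zero_right]; rfl)
  have hpos : 0 < ‖w‖ := norm_pos_iff.2 hw0
  refine ⟨(‖w‖⁻¹ : ℝ) • w, ‖w‖, hpos, ?_, fun x => ?_⟩
  · rw [norm_smul, norm_inv, norm_norm, inv_mul_cancel₀ hpos.ne']
  · rw [inner_smul_right, hw, mul_inv_cancel_left₀ hpos.ne']

theorem deltaPlus_cut_and_flat (p : ℝ) (u : EuclideanSpace ℝ (Fin n)) :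
    (∀ P P₁ P₂ : ConvexPolytope n, ∀ f : EuclideanSpace ℝ (Fin n) →ₗ[ℝ] ℝ, f ≠ 0 → ∀ c,
      P₁.carrier = P.carrier ∩ {x | f x ≤ c} → P₂.carrier = P.carrier ∩ {x | c ≤ f x} →
      deltaPlus p P u = deltaPlus p P₁ u + deltaPlus p P₂ u) ∧
    (∀ P : ConvexPolytope n, ∀ f : EuclideanSpace ℝ (Fin n) →ₗ[ℝ] ℝ, f ≠ 0 → ∀ c,
      (∀ x ∈ P.carrier, f x = c) → deltaPlus p P u = 0) := by
  constructor
  · intro P P₁ P₂ f hf c hP₁ hP₂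
    obtain ⟨w, r, hr, hw, hfw⟩ := exists_unit_normal hf
    simp only [hfw, ← le_div_iff₀' hr, ← div_le_iff₀' hr] at hP₁ hP₂
    exact ConvexPolytope.deltaPlus_cut p u hw hP₁ hP₂
  · intro P f hf c h
    obtain ⟨w, r, hr, hw, hfw⟩ := exists_unit_normal hf
    refine ConvexPolytope.deltaPlus_eq_zero_of_flat p P u hw (c := c / r) fun x hx => ?_
    rw [eq_div_iff hr.ne', mul_comm, ← hfw, h x hx]

end Extension

theorem mainTheorem5 (n : ℕ) (hn : 3 ≤ n) (p : ℝ) (hp : 1 < p)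
    (Φ : ConvexPolytope n → Cp n p)
    (hval : IsValuation Φ) (hsimple : IsSimple Φ) (hcontra : IsSLContravariant Φ)
    (hdens : ∀ y : EuclideanSpace ℝ (Fin n), ∃ a b : ℝ, 0 ≤ a ∧ a < b ∧
      ¬ Dense ((fun s : ℝ => (Φ ((ConvexPolytope.stdSimplex n).dilate s)).1 y) '' Set.Ioo a b)) :
    ∃ c₁ c₂ : ℝ, ∀ (P : ConvexPolytope n) (u : EuclideanSpace ℝ (Fin n)),
      (Φ P).1 u = c₁ * deltaPlus p P u + c₂ * deltaMinus p P u := by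
  obtain ⟨m, rfl⟩ : ∃ m, n = m + 1 := ⟨n - 1, by omega⟩
  obtain ⟨c₁, c₂, hc⟩ := cornerValue_formula hn (by linarith) hval hsimple hcontra hdens
  set V := (MeasureTheory.volume (unitCorner m)).toReal
  have hV : V ≠ 0 := (volume_unitCorner_pos m).ne'
  refine ⟨c₁ / V, c₂ / V, fun P u => ?_⟩
  -- The difference of the two sides at `u`, with `deltaMinus` expressed as `deltaPlus` at `-u`.
  -- Dividing by `V` cancels the volume factor in `deltaPlus_cornerSimplex`.
  let ν : ConvexPolytope (m + 1) → ℝ := fun P =>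
    (Φ P).1 u - (c₁ / V * deltaPlus p P u + c₂ / V * deltaPlus p P (-u))
  have hN : IsDissective (extendByZero ν) := by
    refine isDissective_extendByZero (fun P P₁ P₂ f hf c hP₁ hP₂ => ?_) fun P f hf c h => ?_
    · simp only [ν]
      rw [hval.cut_apply hsimple hf hP₁ hP₂, (deltaPlus_cut_and_flat p u).1 P P₁ P₂ f hf c hP₁ hP₂,
        (deltaPlus_cut_and_flat p (-u)).1 P P₁ P₂ f hf c hP₁ hP₂]
      ring
    · simp only [ν]
      rw [hsimple P (ConvexPolytope.dim_lt_of_flat hf h), (deltaPlus_cut_and_flat p u).2 P f hf c h,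
        (deltaPlus_cut_and_flat p (-u)).2 P f hf c h]
      simp
  have h0 : ∀ x : Fin (m + 1) → EuclideanSpace ℝ (Fin (m + 1)), LinearIndependent ℝ x →
      extendByZero ν (cornerSimplex x) = 0 := by
    intro x hx
    have hcar : (cornerPolytope x).carrier = cornerSimplex x := rfl
    rw [← hcar, extendByZero_carrier]
    obtain ⟨y, rfl⟩ : ∃ y : Fin (m + 1) → ℝ, ∑ i, y i • x i = u := by
      let b := basisOfLinearIndependentOfCardEqFinrank hx (by simp)
      refine ⟨b.repr u, ?_⟩
      conv_rhs => rw [← b.sum_repr u]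
      simp [b]
    have hneg : -∑ i, y i • x i = ∑ i, (-y) i • x i := by simp
    simp only [ν]
    rw [apply_cornerPolytope hn hcontra hc hx, hneg,
      ConvexPolytope.deltaPlus_cornerSimplex p hx hcar,
      ConvexPolytope.deltaPlus_cornerSimplex p hx hcar]
    simp only [Pi.neg_apply, Finset.sum_neg_distrib]
    field_simp
    ring
  have hfinal := hN.eq_zero (by simp) h0 P.isHull
  rw [extendByZero_carrier] at hfinal
  rw [deltaMinus_eq]
  exact sub_eq_zero.1 hfinal
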